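/- Let $f:\mathbb R^N\to\mathbb R$ and $c:\mathbb R^N\to\mathbb R^M$ be twice continuously differentiable, $J$ the Jacobian of $c$, $v(x)=\tfrac12\|c(x)\|^2$, and write $f_k=f(x_k)$, $g_k=\nabla f(x_k)$, $v_k=v(x_k)$, $J_k=J(x_k)$, $c_k=c(x_k)$, $g^v_k=\nabla v(x_k)=J_k^Tc_k$, $H^v_k=\nabla^2v(x_k)$. Norms are Euclidean. **Algorithm (phase 1 trust funnel method).** Constants: $\kappa_n,\kappa_{vm},\kappa_{tn},\kappa_\rho,\kappa_{fm},\kappa_{st},\kappa_{ntt},\kappa_{v1},\kappa_{v2},\gamma_C\in(0,1)$; $\kappa_p,\kappa_{ht},\kappa_{hs},\underline\sigma,\epsilon\in(0,\infty)$; $\kappa_\delta,\gamma_E,\gamma_\lambda\in(1,\infty)$; $\overline\sigma\in[\underline\sigma,\infty)$. Choose $x_0$, $v^{\max}_0\ge\max\{1,v_0\}$, $\sigma_0\in[\underline\sigma,\overline\sigma]$, and $\delta^v_0,\Delta_0,\delta^f_0>0$ with $\delta^v_0\le\Delta_0$. For $k=0,1,2,\dots$: stop if $\|g^v_k\|\le\epsilon$;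 otherwise perform iteration $k$, as follows, with a symmetric matrix $H_k$. *Step.* Let $m^v_k(d)=v_k+(g^v_k)^Td+\frac12d^TH^v_kd$, $m^f_k(d)=f_k+g_k^Td+\frac12d^TH_kd$, and $\delta^s_k=\min\{\kappa_\delta\delta^v_k,\delta^f_k\}$. Let $(n_k,\lambda^v_k)$ be a primal-dual solution of $\min m^v_k(n)$ s.t. $\|n\|\le\delta^v_k$, that is, $n_k$ is a global minimizer, $g^v_k+(H^v_k+\lambda^v_kI)n_k=0$, $H^v_k+\lambda^v_kI\succeq0$, $\lambda^v_k\ge0$, $\lambda^v_k(\delta^v_k-\|n_k\|)=0$. Let $g^p_k$ be the orthogonal projection of $g_k+H_kn_k$ onto $\mathrm{Null}(J_k)$. If $\|n_k\|\le\kappa_n\delta^s_k$ and $\|g^p_k\|\ge\kappa_p\|g^v_k\|$, let $(t_k,\lambda^f_k)$ be a primal-dual solution of $\min m^f_k(n_k+t)$ s.t. $J_kt=0$, $\|n_k+t\|\le\delta^s_k$, that is, $t_k$ is a global minimizer, $(H_k+\lambda^f_kI)(n_k+t_k)+g_k+J_k^Ty=0$ for some $y$, $H_k+\lambda^f_kI\succeq0$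 on $\mathrm{Null}(J_k)$, $\lambda^f_k\ge0$, $\lambda^f_k(\delta^s_k-\|n_k+t_k\|)=0$; but reset $(t_k,\lambda^f_k)=(0,0)$ unless $m^v_k(0)-m^v_k(n_k+t_k)\ge\kappa_{vm}(m^v_k(0)-m^v_k(n_k))$, $\|n_k+t_k\|\ge\kappa_{tn}\|n_k\|$ and $\|H^v_kt_k\|\le\kappa_{ht}\|n_k+t_k\|^2$. Otherwise $(t_k,\lambda^f_k)=(0,0)$. Put $s_k=n_k+t_k$, $\rho^f_k=(f_k-f(x_k+s_k))/\|s_k\|^3$, $\rho^v_k=(v_k-v(x_k+s_k))/\|s_k\|^3$. For $k\ge1$, $\sigma_k=\max\{\sigma_{k-1},\lambda^v_k/\|n_k\|\}$ if iteration $k-1$ was a V-iteration with $\rho^v_{k-1}<\kappa_\rho$, and $\sigma_k=\sigma_{k-1}$ otherwise. Let $Q^v_k(\lambda)$ be the problem $\min_n (g^v_k)^Tn+\frac12n^T(H^v_k+\lambda I)n$ and $Q^f_k(\lambda)$ the problem $\min_t (g_k+(H_k+\lambda I)n_k)^Tt+\frac12t^T(H_k+\lambda I)t$ s.t. $J_kt=0$.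 *F-iteration*: performed if $t_k\ne0$, $\|t_k\|\ge\kappa_{st}\|s_k\|$, $m^f_k(0)-m^f_k(s_k)\ge\kappa_{fm}(m^f_k(n_k)-m^f_k(s_k))$, $v(x_k+s_k)\le v^{\max}_k-\kappa_\rho\|s_k\|^3$, $n_k^Tt_k\ge-\frac12\kappa_{ntt}\|t_k\|^2$, $\lambda^v_k\le\sigma_k\|n_k\|$ and $\|(H_k-\nabla^2f(x_k))s_k\|\le\kappa_{hs}\|s_k\|^2$. Then $\delta^v_{k+1}=\delta^v_k$, $\Delta_{k+1}=\Delta_k$. If $\rho^f_k\ge\kappa_\rho$ (accept): $x_{k+1}=x_k+s_k$, $v^{\max}_{k+1}=\min\{\max\{\kappa_{v1}v^{\max}_k,v^{\max}_k-\kappa_\rho\|s_k\|^3\},\,v_{k+1}+\kappa_{v2}(v^{\max}_k-v_{k+1})\}$, $\delta^f_{k+1}=\max\{\delta^f_k,\gamma_E\|s_k\|\}$. Otherwise $x_{k+1}=x_k$, $v^{\max}_{k+1}=v^{\max}_k$, the normal step and the matrix are kept ($n_{k+1}=n_k$, $H_{k+1}=H_k$), and $\delta^f_{k+1}=\gamma_C\|s_k\|$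 if $\lambda^f_k\ge\underline\sigma\|s_k\|$, while if $\lambda^f_k<\underline\sigma\|s_k\|$ then $\delta^f_{k+1}=\|n_k+t\|$ for a solution $t$ of $Q^f_k(\lambda)$ with some $\lambda>\lambda^f_k$ such that $\lambda/\|n_k+t\|\ge\underline\sigma$. *V-iteration*: performed otherwise, with $\delta^f_{k+1}=\delta^f_k$. (Accept) If $\rho^v_k\ge\kappa_\rho$ and ($\lambda^v_k\le\sigma_k\|n_k\|$ or $\|n_k\|=\Delta_k$): $x_{k+1}=x_k+s_k$, $v^{\max}_{k+1}=\min\{\max\{\kappa_{v1}v^{\max}_k,v_{k+1}+\kappa_{v2}(v_k-v_{k+1})\},\,v_{k+1}+\kappa_{v2}(v^{\max}_k-v_{k+1})\}$, $\Delta_{k+1}=\max\{\Delta_k,\gamma_E\|n_k\|\}$, $\delta^v_{k+1}=\min\{\Delta_{k+1},\max\{\delta^v_k,\gamma_E\|n_k\|\}\}$. In the other cases $x_{k+1}=x_k$, $v^{\max}_{k+1}=v^{\max}_k$, $\Delta_{k+1}=\Delta_k$. (Expand) If $\rho^v_k\ge\kappa_\rho$ but the step is not accepted: $\delta^v_{k+1}=\min\{\Delta_{k+1},\lambda^v_k/\sigma_k\}$.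 (Contract) If $\rho^v_k<\kappa_\rho$ and $\lambda^v_k<\underline\sigma\|n_k\|$: let $\hat\lambda=\lambda^v_k+(\underline\sigma\|g^v_k\|)^{1/2}$ and let $\hat n$ solve $Q^v_k(\hat\lambda)$; if $\hat\lambda/\|\hat n\|\le\overline\sigma$ then $\delta^v_{k+1}=\|\hat n\|$, else $\delta^v_{k+1}=\|n\|$ for a solution $n$ of $Q^v_k(\lambda)$ with some $\lambda\in(\lambda^v_k,\hat\lambda)$ such that $\underline\sigma\le\lambda/\|n\|\le\overline\sigma$. If $\rho^v_k<\kappa_\rho$ and $\lambda^v_k\ge\underline\sigma\|n_k\|$: let $n$ solve $Q^v_k(\gamma_\lambda\lambda^v_k)$ and set $\delta^v_{k+1}=\max\{\|n\|,\gamma_C\|n_k\|\}$. **Theorem.** Fix the constants of the algorithm other than $\epsilon$, and fix $L_v,L_f>0$, $v^{\max}_0\ge1$, $\Delta_0>0$. Define $$\sigma_{\max}=\max\Big\{\overline\sigma,\ \frac{\gamma_\lambda}{\gamma_C}\,\frac{\kappa_\delta^3}{\kappa_{vm}}\,(L_v+2\kappa_\rho)\Big\},\qquad K_\sigma(\epsilon)=\left\lfloor\frac{v^{\max}_0}{\kappa_\rho(1-\kappa_{v2})\,(L_v+\kappa_{ht}+\sigma_{\max}/\kappa_{tn}^2)^{-3/2}}\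 \epsilon^{-3/2}\right\rfloor,$$ $$K^v_\Delta=\left\lfloor\frac{v^{\max}_0}{\kappa_\rho\kappa_{tn}^3(1-\kappa_{v2})\Delta_0^3}\right\rfloor,\qquad K^v_C=1+\left\lfloor\frac{\log(\sigma_{\max}/\underline\sigma)}{\log(\min\{\gamma_\lambda,\gamma_C^{-1}\})}\right\rfloor,$$ $$K^f_C=\max\left\{1,\ 2+\left\lfloor\frac1{\log(\gamma_C^{-1})}\log\frac{\kappa_{hs}+L_f+2\kappa_\rho}{\underline\sigma\,\kappa_{fm}\kappa_{st}^2(1-\kappa_{ntt})}\right\rfloor\right\},$$ $$K(\epsilon)=\big(1+K_\sigma(\epsilon)+K^v_\Delta\big)\big(1+(K^v_C+1)(K^f_C+1)\big).$$ 1. Let $\epsilon>0$ and consider any run of the algorithm with this tolerance, with these $v^{\max}_0,\Delta_0$, for any twice continuously differentiable $f,c$, such that the iterates lie in a compact set, the matrices $H_k$ are bounded, and $\nabla^2v$ and $\nabla^2f$ are Lipschitz continuous with constants $L_v$ and $L_f$ on each segment from an iterate $x_k$ to its trial point $x_k+s_k$. Then the number of performed iterations, i.e. of reached indices $k$ with $\|J_k^Tc_k\|>\epsilon$,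 is finite and at most $K(\epsilon)$. In particular the method stops at some $x_k$ with $k\le K(\epsilon)$ and $\|\nabla v(x_k)\|\le\epsilon$. 2. For every $\bar\epsilon>0$ there is a constant $C$, independent of $\epsilon$, with $0\le K(\epsilon)\le C\,\epsilon^{-3/2}$ for all $\epsilon\in(0,\bar\epsilon)$; that is, $K(\epsilon)=O(\epsilon^{-3/2})$. -/

import Mathlib

open scoped InnerProductSpace

noncomputable section

namespace TrustFunnel

/-- Euclidean space of dimension `n`, with the 2-norm. -/
abbrev Vec (n : ℕ) := EuclideanSpace ℝ (Fin n)

/-- The input constants of the trust funnel method, with their admissible ranges. -/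
structure Params where
  κn : ℝ
  κvm : ℝ
  κtn : ℝ
  κρ : ℝ
  κfm : ℝ
  κst : ℝ
  κntt : ℝ
  κv1 : ℝ
  κv2 : ℝ
  γc : ℝ
  κp : ℝ
  κht : ℝ
  κhs : ℝ
  σlo : ℝ
  σhi : ℝ
  κδ : ℝ
  γe : ℝ
  γlam : ℝ
  κn_mem : κn ∈ Set.Ioo (0 : ℝ) 1
  κvm_mem : κvm ∈ Set.Ioo (0 : ℝ) 1
  κtn_mem : κtn ∈ Set.Ioo (0 : ℝ) 1
  κρ_mem : κρ ∈ Set.Ioo (0 : ℝ) 1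
  κfm_mem : κfm ∈ Set.Ioo (0 : ℝ) 1
  κst_mem : κst ∈ Set.Ioo (0 : ℝ) 1
  κntt_mem : κntt ∈ Set.Ioo (0 : ℝ) 1
  κv1_mem : κv1 ∈ Set.Ioo (0 : ℝ) 1
  κv2_mem : κv2 ∈ Set.Ioo (0 : ℝ) 1
  γc_mem : γc ∈ Set.Ioo (0 : ℝ) 1
  κp_pos : 0 < κp
  κht_pos : 0 < κht
  κhs_pos : 0 < κhs
  σlo_pos : 0 < σlo
  σlo_le_σhi : σlo ≤ σhi
  one_lt_κδ : 1 < κδ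
  one_lt_γe : 1 < γe
  one_lt_γlam : 1 < γlam

variable {N M : ℕ}

/-! ### Problem functions -/

/-- The infeasibility measure `v(x) = ‖c(x)‖² / 2`. -/
def viol (c : Vec N → Vec M) (x : Vec N) : ℝ := 1 / 2 * ‖c x‖ ^ 2

/-- The Jacobian `J(x)` of `c`. -/
def jac (c : Vec N → Vec M) (x : Vec N) : Vec N →L[ℝ] Vec M := fderiv ℝ c x

/-- `g^v(x) = J(x)ᵀ c(x)`. -/
def gv (c : Vec N → Vec M) (x : Vec N) : Vec N :=
  ContinuousLinearMap.adjoint (jac c x) (c x)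

/-- `g^v` is the gradient of the infeasibility measure. -/
theorem gradient_viol (c : Vec N → Vec M) (x : Vec N) (hc : DifferentiableAt ℝ c x) :
    gradient (viol c) x = gv c x := by
  apply HasGradientAt.gradient
  rw [hasGradientAt_iff_hasFDerivAt]
  have h := (hc.hasFDerivAt.norm_sq).const_mul (1 / 2 : ℝ)
  refine h.congr_fderiv ?_
  ext w
  simp [gv, jac, ContinuousLinearMap.adjoint_inner_left]

/-- The Hessian of `φ`, as an operator: the derivative of the gradient. -/
def hess (φ : Vec N → ℝ) (x : Vec N) : Vec N →L[ℝ] Vec N := fderiv ℝ (gradient φ) x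

/-- The second-order model `m^v` of the infeasibility measure at `x`. -/
def mv (c : Vec N → Vec M) (x d : Vec N) : ℝ :=
  viol c x + ⟪gv c x, d⟫_ℝ + 1 / 2 * ⟪d, hess (viol c) x d⟫_ℝ

/-- The quadratic model `m^f` of the objective at `x` with symmetric matrix `H`. -/
def mf (f : Vec N → ℝ) (x : Vec N) (H : Vec N →L[ℝ] Vec N) (d : Vec N) : ℝ :=
  f x + ⟪gradient f x, d⟫_ℝ + 1 / 2 * ⟪d, H d⟫_ℝ

/-! ### Subproblems -/

/-- `(n, lam)` is a primal-dual solution of: minimize `m^v(n)` subject to `‖n‖ ≤ δ`. -/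
def NormalSol (c : Vec N → Vec M) (x : Vec N) (δ : ℝ) (n : Vec N) (lam : ℝ) : Prop :=
  ‖n‖ ≤ δ ∧ (∀ d : Vec N, ‖d‖ ≤ δ → mv c x n ≤ mv c x d) ∧
  gv c x + (hess (viol c) x n + lam • n) = 0 ∧
  (∀ d : Vec N, 0 ≤ ⟪d, hess (viol c) x d + lam • d⟫_ℝ) ∧
  0 ≤ lam ∧ lam * (δ - ‖n‖) = 0

/-- `n` solves the regularized normal subproblem `Q^v(lam)`. -/
def QvSol (c : Vec N → Vec M) (x : Vec N) (lam : ℝ) (n : Vec N) : Prop :=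
  ∀ d : Vec N,
    viol c x + ⟪gv c x, n⟫_ℝ + 1 / 2 * ⟪n, hess (viol c) x n + lam • n⟫_ℝ ≤
    viol c x + ⟪gv c x, d⟫_ℝ + 1 / 2 * ⟪d, hess (viol c) x d + lam • d⟫_ℝ

/-- `(t, lam)` is (with some multiplier `y` for `J t = 0`) a primal-dual solution of:
minimize `m^f(n + t)` subject to `J t = 0` and `‖n + t‖ ≤ δ`. -/
def TangSol (f : Vec N → ℝ) (c : Vec N → Vec M) (x : Vec N) (H : Vec N →L[ℝ] Vec N)
    (n : Vec N) (δ : ℝ) (t : Vec N) (lam : ℝ) : Prop :=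
  jac c x t = 0 ∧ ‖n + t‖ ≤ δ ∧
  (∀ d : Vec N, jac c x d = 0 → ‖n + d‖ ≤ δ → mf f x H (n + t) ≤ mf f x H (n + d)) ∧
  (∃ y : Vec M, H t + lam • t + ContinuousLinearMap.adjoint (jac c x) y =
    -(gradient f x + (H n + lam • n))) ∧
  (∀ d : Vec N, jac c x d = 0 → 0 ≤ ⟪d, H d + lam • d⟫_ℝ) ∧
  0 ≤ lam ∧ lam * (δ - ‖n + t‖) = 0

/-- `t` solves the regularized tangential subproblem `Q^f(lam)`. -/
def QfSol (f : Vec N → ℝ) (c : Vec N → Vec M) (x : Vec N) (H : Vec N →L[ℝ] Vec N)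
    (n : Vec N) (lam : ℝ) (t : Vec N) : Prop :=
  jac c x t = 0 ∧ ∀ d : Vec N, jac c x d = 0 →
    ⟪gradient f x + (H n + lam • n), t⟫_ℝ + 1 / 2 * ⟪t, H t + lam • t⟫_ℝ ≤
    ⟪gradient f x + (H n + lam • n), d⟫_ℝ + 1 / 2 * ⟪d, H d + lam • d⟫_ℝ

/-- The projected gradient `g^p = Z Zᵀ (∇f(x) + H n)`, i.e. the orthogonal projection onto the
null space of the Jacobian. -/
def gp (f : Vec N → ℝ) (c : Vec N → Vec M) (x : Vec N) (H : Vec N →L[ℝ] Vec N)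
    (n : Vec N) : Vec N :=
  (LinearMap.ker (jac c x : Vec N →ₗ[ℝ] Vec M)).starProjection (gradient f x + H n)

/-! ### The algorithm -/

/-- The quantities attached to one iteration. -/
structure Iter (N : ℕ) where
  /-- iterate -/
  x : Vec N
  /-- normal step -/
  n : Vec N
  /-- tangential step (zero if not computed or reset) -/
  t : Vec N
  /-- matrix of the objective model -/
  H : Vec N →L[ℝ] Vec N
  /-- trust funnel radius -/
  vmax : ℝ
  /-- trust region radius of the normal subproblem -/
  δv : ℝ
  /-- upper bound on `δv` -/
  δmax : ℝ
  /-- trust region radius for the objective -/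
  δf : ℝ
  /-- dual variable of the normal trust region constraint -/
  lamv : ℝ
  /-- dual variable of the tangential trust region constraint -/
  lamf : ℝ
  /-- upper bound on the admissible ratio `lamv / ‖n‖` -/
  σ : ℝ

/-- The full step `s = n + t`. -/
def Iter.s (D : Iter N) : Vec N := D.n + D.t

/-- `δ^s = min {κδ δ^v, δ^f}`. -/
def Iter.δs (P : Params) (D : Iter N) : ℝ := min (P.κδ * D.δv) D.δf

/-- The conditions under which a tangential step `t` is not reset to zero. -/
def KeepTang (P : Params) (c : Vec N → Vec M) (x n t : Vec N) : Prop :=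
  mv c x 0 - mv c x (n + t) ≥ P.κvm * (mv c x 0 - mv c x n) ∧
  ‖n + t‖ ≥ P.κtn * ‖n‖ ∧
  ‖hess (viol c) x t‖ ≤ P.κht * ‖n + t‖ ^ 2

/-- The test for computing a tangential step. -/
def TryTang (P : Params) (f : Vec N → ℝ) (c : Vec N → Vec M) (D : Iter N) : Prop :=
  ‖D.n‖ ≤ P.κn * D.δs P ∧ ‖gp f c D.x D.H D.n‖ ≥ P.κp * ‖gv c D.x‖

/-- `n, lamv, t, lamf` are possible outputs of the step computation. -/
def ComputeSteps (P : Params) (f : Vec N → ℝ) (c : Vec N → Vec M) (D : Iter N) : Prop :=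
  NormalSol c D.x D.δv D.n D.lamv ∧
  (TryTang P f c D → ∃ (t : Vec N) (lam : ℝ), TangSol f c D.x D.H D.n (D.δs P) t lam ∧
    ((KeepTang P c D.x D.n t ∧ D.t = t ∧ D.lamf = lam) ∨
     (¬ KeepTang P c D.x D.n t ∧ D.t = 0 ∧ D.lamf = 0))) ∧
  (¬ TryTang P f c D → D.t = 0 ∧ D.lamf = 0)

/-- The conditions making an iteration an F-iteration (otherwise it is a V-iteration). -/
def IsF (P : Params) (f : Vec N → ℝ) (c : Vec N → Vec M) (D : Iter N) : Prop :=
  (D.t ≠ 0 ∧ ‖D.t‖ ≥ P.κst * ‖D.s‖) ∧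
  mf f D.x D.H 0 - mf f D.x D.H D.s ≥ P.κfm * (mf f D.x D.H D.n - mf f D.x D.H D.s) ∧
  viol c (D.x + D.s) ≤ D.vmax - P.κρ * ‖D.s‖ ^ 3 ∧
  ⟪D.n, D.t⟫_ℝ ≥ -(1 / 2) * P.κntt * ‖D.t‖ ^ 2 ∧
  D.lamv ≤ D.σ * ‖D.n‖ ∧
  ‖(D.H - hess f D.x) D.s‖ ≤ P.κhs * ‖D.s‖ ^ 2

/-- `ρ^f`. -/
def rhoF (f : Vec N → ℝ) (D : Iter N) : ℝ := (f D.x - f (D.x + D.s)) / ‖D.s‖ ^ 3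

/-- `ρ^v`. -/
def rhoV (c : Vec N → Vec M) (D : Iter N) : ℝ :=
  (viol c D.x - viol c (D.x + D.s)) / ‖D.s‖ ^ 3

/-- `r` is a possible value returned by the contraction procedure of an F-iteration. -/
def FContract (P : Params) (f : Vec N → ℝ) (c : Vec N → Vec M) (D : Iter N) (r : ℝ) : Prop :=
  (D.lamf < P.σlo * ‖D.s‖ ∧ ∃ (lam : ℝ) (t : Vec N), D.lamf < lam ∧
    QfSol f c D.x D.H D.n lam t ∧ P.σlo ≤ lam / ‖D.n + t‖ ∧ r = ‖D.n + t‖) ∨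
  (D.lamf ≥ P.σlo * ‖D.s‖ ∧ r = P.γc * ‖D.s‖)

/-- `r` is a possible value returned by the contraction procedure of a V-iteration. -/
def VContract (P : Params) (c : Vec N → Vec M) (D : Iter N) (r : ℝ) : Prop :=
  (D.lamv < P.σlo * ‖D.n‖ ∧
    ∃ nhat : Vec N, QvSol c D.x (D.lamv + Real.sqrt (P.σlo * ‖gv c D.x‖)) nhat ∧
      (((D.lamv + Real.sqrt (P.σlo * ‖gv c D.x‖)) / ‖nhat‖ ≤ P.σhi ∧ r = ‖nhat‖) ∨
       (¬ (D.lamv + Real.sqrt (P.σlo * ‖gv c D.x‖)) / ‖nhat‖ ≤ P.σhi ∧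
        ∃ (lam : ℝ) (n : Vec N),
          lam ∈ Set.Ioo D.lamv (D.lamv + Real.sqrt (P.σlo * ‖gv c D.x‖)) ∧
          QvSol c D.x lam n ∧ P.σlo ≤ lam / ‖n‖ ∧ lam / ‖n‖ ≤ P.σhi ∧ r = ‖n‖))) ∨
  (D.lamv ≥ P.σlo * ‖D.n‖ ∧
    ∃ n : Vec N, QvSol c D.x (P.γlam * D.lamv) n ∧
      ((‖n‖ ≥ P.γc * ‖D.n‖ ∧ r = ‖n‖) ∨ (¬ ‖n‖ ≥ P.γc * ‖D.n‖ ∧ r = P.γc * ‖D.n‖)))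

/-- The update made by an F-iteration.  After a rejected step the iterate and `δ^v` do not change,
so the normal subproblem is the same one; its solution and the matrix `H` are kept. -/
def FUpdate (P : Params) (f : Vec N → ℝ) (c : Vec N → Vec M) (D D' : Iter N) : Prop :=
  D'.δv = D.δv ∧ D'.δmax = D.δmax ∧
  ((rhoF f D ≥ P.κρ ∧
      D'.x = D.x + D.s ∧
      D'.vmax = min (max (P.κv1 * D.vmax) (D.vmax - P.κρ * ‖D.s‖ ^ 3))
        (viol c D'.x + P.κv2 * (D.vmax - viol c D'.x)) ∧
      D'.δf = max D.δf (P.γe * ‖D.s‖)) ∨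
   (rhoF f D < P.κρ ∧
      D'.x = D.x ∧ D'.n = D.n ∧ D'.H = D.H ∧
      D'.vmax = D.vmax ∧
      FContract P f c D D'.δf))

/-- The update made by a V-iteration: accepted step, contraction, or expansion. -/
def VUpdate (P : Params) (c : Vec N → Vec M) (D D' : Iter N) : Prop :=
  D'.δf = D.δf ∧
  ((rhoV c D ≥ P.κρ ∧ (D.lamv ≤ D.σ * ‖D.n‖ ∨ ‖D.n‖ = D.δmax) ∧
      D'.x = D.x + D.s ∧
      D'.vmax = min (max (P.κv1 * D.vmax) (viol c D'.x + P.κv2 * (viol c D.x - viol c D'.x)))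
        (viol c D'.x + P.κv2 * (D.vmax - viol c D'.x)) ∧
      D'.δmax = max D.δmax (P.γe * ‖D.n‖) ∧
      D'.δv = min D'.δmax (max D.δv (P.γe * ‖D.n‖))) ∨
   (rhoV c D < P.κρ ∧
      D'.x = D.x ∧ D'.vmax = D.vmax ∧ D'.δmax = D.δmax ∧
      VContract P c D D'.δv) ∨
   (rhoV c D ≥ P.κρ ∧ ¬ (D.lamv ≤ D.σ * ‖D.n‖ ∨ ‖D.n‖ = D.δmax) ∧
      D'.x = D.x ∧ D'.vmax = D.vmax ∧ D'.δmax = D.δmax ∧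
      D'.δv = min D'.δmax (D.lamv / D.σ)))

/-- The iterations performed before termination: those `k` with `‖g^v_k‖ > ε` that are reached,
i.e. the termination test `‖g^v_j‖ ≤ ε` has failed for every `j ≤ k`. -/
def performed (c : Vec N → Vec M) (ε : ℝ) (R : ℕ → Iter N) : Set ℕ :=
  {k | ∀ j ≤ k, ε < ‖gv c (R j).x‖}

/-- `R` is a run of the phase 1 method with tolerance `ε`.  Nothing is required of entries of `R`
after termination. -/
structure IsRun (P : Params) (f : Vec N → ℝ) (c : Vec N → Vec M) (ε : ℝ)
    (R : ℕ → Iter N) : Prop where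
  init_vmax : max 1 (viol c (R 0).x) ≤ (R 0).vmax
  init_σ : (R 0).σ ∈ Set.Icc P.σlo P.σhi
  init_δv : 0 < (R 0).δv
  init_δf : 0 < (R 0).δf
  init_δmax : (R 0).δv ≤ (R 0).δmax
  symm : ∀ k ∈ performed c ε R, IsSelfAdjoint (R k).H
  steps : ∀ k ∈ performed c ε R, ComputeSteps P f c (R k)
  update_F : ∀ k ∈ performed c ε R, IsF P f c (R k) → FUpdate P f c (R k) (R (k + 1))
  update_V : ∀ k ∈ performed c ε R, ¬ IsF P f c (R k) → VUpdate P c (R k) (R (k + 1))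
  sigma_contract : ∀ k, k + 1 ∈ performed c ε R → ¬ IsF P f c (R k) → rhoV c (R k) < P.κρ →
    (R (k + 1)).σ = max (R k).σ ((R (k + 1)).lamv / ‖(R (k + 1)).n‖)
  sigma_same : ∀ k, k + 1 ∈ performed c ε R → (IsF P f c (R k) ∨ P.κρ ≤ rhoV c (R k)) →
    (R (k + 1)).σ = (R k).σ

/-- The iterates lie in a compact set and the matrices `H_k` are bounded. -/
def BoundedRun (c : Vec N → Vec M) (ε : ℝ) (R : ℕ → Iter N) : Prop :=
  (∃ S : Set (Vec N), IsCompact S ∧ (R 0).x ∈ S ∧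
    ∀ k ∈ performed c ε R, (R k).x ∈ S ∧ (R (k + 1)).x ∈ S) ∧
  ∃ B : ℝ, ∀ k ∈ performed c ε R, ‖(R k).H‖ ≤ B

/-- The Hessian of `φ` is Lipschitz continuous with constant `L` along each segment from an iterate
`x_k` to the trial point `x_k + s_k`. -/
def LipschitzHessAlong (c : Vec N → Vec M) (ε : ℝ) (R : ℕ → Iter N) (φ : Vec N → ℝ) (L : ℝ) :
    Prop :=
  ∀ k ∈ performed c ε R, ∀ y ∈ segment ℝ (R k).x ((R k).x + (R k).s),
    ∀ z ∈ segment ℝ (R k).x ((R k).x + (R k).s), ‖hess φ y - hess φ z‖ ≤ L * ‖y - z‖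

/-! ### The constants of the bound

`Lv`, `Lf` are the Lipschitz constants of the Hessians of `v` and `f`, `V` is the initial trust
funnel radius and `Δ` the initial value of `δmax`. -/

/-- A bound on all `σ_k`. -/
def sigmaMax (P : Params) (Lv : ℝ) : ℝ :=
  max P.σhi (P.γlam / P.γc * (P.κδ ^ 3 / P.κvm) * (Lv + 2 * P.κρ))

/-- `K_σ(ε)`. -/
def Kσ (P : Params) (Lv V ε : ℝ) : ℤ :=
  ⌊V / (P.κρ * (1 - P.κv2) * (Lv + P.κht + sigmaMax P Lv / P.κtn ^ 2) ^ (-(3 / 2) : ℝ)) *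
    ε ^ (-(3 / 2) : ℝ)⌋

/-- `K_Δ^v`. -/
def KΔ (P : Params) (V Δ : ℝ) : ℤ :=
  ⌊V / (P.κρ * P.κtn ^ 3 * (1 - P.κv2) * Δ ^ 3)⌋

/-- `K_C^v`. -/
def KCv (P : Params) (Lv : ℝ) : ℤ :=
  1 + ⌊1 / Real.log (min P.γlam P.γc⁻¹) * Real.log (sigmaMax P Lv / P.σlo)⌋

/-- `K_C^f`. -/
def KCf (P : Params) (Lf : ℝ) : ℤ :=
  max 1 (2 + ⌊1 / Real.log P.γc⁻¹ *
    Real.log ((P.κhs + Lf + 2 * P.κρ) / (P.σlo * P.κfm * P.κst ^ 2 * (1 - P.κntt)))⌋)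

/-- The iteration bound `K(ε)`. -/
def K (P : Params) (Lv Lf V Δ ε : ℝ) : ℤ :=
  (1 + Kσ P Lv V ε + KΔ P V Δ) * (1 + (KCv P Lv + 1) * (KCf P Lf + 1))

end TrustFunnel

end

noncomputable section

namespace TrustFunnel

variable {N M : ℕ}

/-! ### Smoothness, symmetry and Taylor bounds -/

/-! Every accepted step before the last performed index lowers the funnel radius `vmax` by a fixed
positive amount, and only boundedly many iterations fit between accepted steps. Since `vmax` starts
at `V` and stays above `viol`, hence above `0`, the total is bounded.

Decrease. An update of `vmax` keeps at least the fraction `1 - κv2` of its gap to the new violation,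
and that gap is at least `κρ ‖s‖ ^ 3` (`vmax_decrease`). So `‖s‖` has to be bounded below. If `lamv
≤ σ ‖n‖`, stationarity and Taylor expansion bound the new gradient by a multiple of `‖s‖ ^ 2`
(`norm_gv_add_le`); as it still exceeds `ε`, `‖s‖ ^ 3` is at least of order `ε ^ (3/2)`. Otherwise
`‖n‖ = δmax`, which never falls below its initial value.

Gaps. Larger regularization gives shorter solutions (`inner_le_of_multiplier_lt`). Hence a
contraction raises the ratio of multiplier to step length, first to `σlo` and then by a fixed factor
each time (`VContract.next`, `FContract.next`). A failed step has bounded ratio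
(`multiplier_le_of_rhoV_lt`, `multiplier_lt_of_rhoF_lt`), so the contractions number at most a
logarithm. An expansion can only come first in a gap. The induction carries all of this in
`CountInv`; the two `succ` lemmas are its inductive step. -/

theorem gradient_eq_toDual_symm (φ : Vec N → ℝ) :
    gradient φ = fun x => (InnerProductSpace.toDual ℝ (Vec N)).symm (fderiv ℝ φ x) := rfl

theorem contDiff_gradient {φ : Vec N → ℝ} (hφ : ContDiff ℝ 2 φ) : ContDiff ℝ 1 (gradient φ) := by
  rw [gradient_eq_toDual_symm]
  exact (InnerProductSpace.toDual ℝ (Vec N)).symm.contDiff.comp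
    (hφ.fderiv_right (m := 1) (by norm_num))

theorem hasFDerivAt_gradient {φ : Vec N → ℝ} (hφ : ContDiff ℝ 2 φ) (x : Vec N) :
    HasFDerivAt (gradient φ) (hess φ x) x :=
  ((contDiff_gradient hφ).differentiable (by norm_num) x).hasFDerivAt

/-- Both sides are derivatives of the same scalar function `y ↦ fderiv ℝ φ y b`. This makes the
symmetry of second Fréchet derivatives available for `hess`. -/
theorem inner_hess_apply {φ : Vec N → ℝ} (hφ : ContDiff ℝ 2 φ) (x a b : Vec N) :
    ⟪hess φ x a, b⟫_ℝ = fderiv ℝ (fderiv ℝ φ) x a b := by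
  have h1 : DifferentiableAt ℝ (fderiv ℝ φ) x :=
    (hφ.fderiv_right (m := 1) (by norm_num)).differentiable (by norm_num) x
  have h2 : HasFDerivAt (fun y => ⟪gradient φ y, b⟫_ℝ) _ x :=
    (hasFDerivAt_gradient hφ x).inner ℝ (hasFDerivAt_const b x)
  have h3 : HasFDerivAt (fun y => fderiv ℝ φ y b) _ x :=
    h1.hasFDerivAt.clm_apply (hasFDerivAt_const b x)
  have h4 : (fun y => ⟪gradient φ y, b⟫_ℝ) = fun y => fderiv ℝ φ y b :=
    funext fun y => InnerProductSpace.toDual_symm_apply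
  rw [h4] at h2
  simpa using congrArg (fun T => T a) (h2.unique h3)

theorem inner_hess_comm {φ : Vec N → ℝ} (hφ : ContDiff ℝ 2 φ) (x a b : Vec N) :
    ⟪a, hess φ x b⟫_ℝ = ⟪b, hess φ x a⟫_ℝ := by
  rw [real_inner_comm, inner_hess_apply hφ, real_inner_comm, inner_hess_apply hφ]
  exact (hφ.contDiffAt.isSymmSndFDerivAt (by simp)).eq b a

theorem contDiff_viol {c : Vec N → Vec M} (hc : ContDiff ℝ 2 c) : ContDiff ℝ 2 (viol c) :=
  contDiff_const.mul (hc.norm_sq ℝ)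

theorem gradient_viol_eq {c : Vec N → Vec M} (hc : ContDiff ℝ 2 c) (x : Vec N) :
    gradient (viol c) x = gv c x :=
  gradient_viol c x (hc.differentiable (by norm_num) x)

theorem viol_nonneg (c : Vec N → Vec M) (x : Vec N) : 0 ≤ viol c x := by
  unfold viol; positivity

/-- The Hessian of `φ` is Lipschitz with constant `L` on the segment from `x` to `x + s`. -/
def HessLipOn (φ : Vec N → ℝ) (L : ℝ) (x s : Vec N) : Prop :=
  ∀ y ∈ segment ℝ x (x + s), ∀ z ∈ segment ℝ x (x + s), ‖hess φ y - hess φ z‖ ≤ L * ‖y - z‖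

theorem mem_segment_add_smul (x s : Vec N) {τ : ℝ} (h0 : 0 ≤ τ) (h1 : τ ≤ 1) :
    x + τ • s ∈ segment ℝ x (x + s) := by
  rw [segment_eq_image']
  exact ⟨τ, ⟨h0, h1⟩, by simp⟩

theorem HessLipOn.smul {φ : Vec N → ℝ} {L : ℝ} {x s : Vec N} (h : HessLipOn φ L x s) {τ : ℝ}
    (h0 : 0 ≤ τ) (h1 : τ ≤ 1) : HessLipOn φ L x (τ • s) := by
  have hsub : segment ℝ x (x + τ • s) ⊆ segment ℝ x (x + s) :=
    (convex_segment _ _).segment_subset (left_mem_segment ℝ _ _) (mem_segment_add_smul x s h0 h1)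
  exact fun y hy z hz => h y (hsub hy) z (hsub hz)

/-- Mean value inequality for the gradient minus its linearization: on the segment its derivative
has norm at most `L * ‖s‖`. The sharper `L / 2` is not needed for the stated constants. -/
theorem norm_gradient_sub_le {φ : Vec N → ℝ} (hφ : ContDiff ℝ 2 φ) {L : ℝ} (hL : 0 ≤ L)
    {x s : Vec N} (h : HessLipOn φ L x s) :
    ‖gradient φ (x + s) - gradient φ x - hess φ x s‖ ≤ L * ‖s‖ ^ 2 := by
  have key := (convex_segment (𝕜 := ℝ) x (x + s)).norm_image_sub_le_of_norm_hasFDerivWithin_le'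
    (f := gradient φ) (f' := hess φ) (φ := hess φ x) (C := L * ‖s‖)
    (fun y _ => (hasFDerivAt_gradient hφ y).hasFDerivWithinAt)
    (fun y hy => by
      refine (h y hy x (left_mem_segment ℝ _ _)).trans (mul_le_mul_of_nonneg_left ?_ hL)
      have := norm_sub_le_of_mem_segment hy
      simpa using this)
    (left_mem_segment ℝ _ _) (right_mem_segment ℝ _ _)
  simpa [pow_two, mul_assoc] using key

theorem le_quadratic_add_cube {φ : Vec N → ℝ} (hφ : ContDiff ℝ 2 φ) {L : ℝ} (hL : 0 ≤ L)
    {x s : Vec N} (h : HessLipOn φ L x s) :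
    φ (x + s) ≤ φ x + ⟪gradient φ x, s⟫_ℝ + 1 / 2 * ⟪s, hess φ x s⟫_ℝ + L / 2 * ‖s‖ ^ 3 := by
  set a := ⟪gradient φ x, s⟫_ℝ
  set b := ⟪s, hess φ x s⟫_ℝ
  -- The error term carries `τ ^ 2`, not `τ ^ 3`: its derivative `τ * L * ‖s‖ ^ 3` dominates the
  -- gradient error `L * τ ^ 2 * ‖s‖ ^ 3` on `[0, 1]`, so `k` is antitone.
  let k : ℝ → ℝ := fun τ => φ (x + τ • s) - τ * a - τ ^ 2 * (1 / 2 * b + L / 2 * ‖s‖ ^ 3)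
  have hd : ∀ τ : ℝ, HasDerivAt k (⟪gradient φ (x + τ • s), s⟫_ℝ - a -
      2 * τ * (1 / 2 * b + L / 2 * ‖s‖ ^ 3)) τ := by
    intro τ
    have h1 : HasDerivAt (fun τ : ℝ => x + τ • s) s τ := by
      simpa using ((hasDerivAt_id τ).smul_const s).const_add x
    have h2 : HasFDerivAt φ (fderiv ℝ φ (x + τ • s)) (x + τ • s) :=
      (hφ.differentiable (by norm_num) _).hasFDerivAt
    have h3 := h2.comp_hasDerivAt τ h1
    have h4 : ⟪gradient φ (x + τ • s), s⟫_ℝ = fderiv ℝ φ (x + τ • s) s :=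
      InnerProductSpace.toDual_symm_apply
    rw [h4]
    have h5 : HasDerivAt (fun τ : ℝ => τ * a) a τ := by
      simpa using (hasDerivAt_id τ).mul_const a
    have h6 : HasDerivAt (fun τ : ℝ => τ ^ 2 * (1 / 2 * b + L / 2 * ‖s‖ ^ 3))
        (2 * τ * (1 / 2 * b + L / 2 * ‖s‖ ^ 3)) τ := by
      simpa using (hasDerivAt_pow 2 τ).mul_const (1 / 2 * b + L / 2 * ‖s‖ ^ 3)
    exact (h3.sub h5).sub h6
  have hanti : AntitoneOn k (Set.Icc 0 1) := by
    refine antitoneOn_of_deriv_nonpos (convex_Icc 0 1)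
      (fun τ _ => (hd τ).continuousAt.continuousWithinAt)
      (fun τ _ => (hd τ).differentiableAt.differentiableWithinAt) ?_
    intro τ hτ
    rw [interior_Icc] at hτ
    rw [(hd τ).deriv]
    have h1 := norm_gradient_sub_le hφ hL (h.smul hτ.1.le hτ.2.le)
    have h2 := real_inner_le_norm (gradient φ (x + τ • s) - gradient φ x - hess φ x (τ • s)) s
    rw [inner_sub_left, inner_sub_left, map_smul, real_inner_smul_left,
      real_inner_comm s (hess φ x s)] at h2
    have h3 : ‖τ • s‖ = τ * ‖s‖ := by rw [norm_smul, Real.norm_of_nonneg hτ.1.le]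
    rw [h3] at h1
    have h4 := mul_le_mul_of_nonneg_right h1 (norm_nonneg s)
    rw [map_smul] at h4
    have h5 : L * (τ * ‖s‖) ^ 2 * ‖s‖ ≤ τ * (L * ‖s‖ ^ 3) := by
      have : τ ^ 2 * (L * ‖s‖ ^ 3) ≤ τ * (L * ‖s‖ ^ 3) :=
        mul_le_mul_of_nonneg_right (by nlinarith [hτ.1, hτ.2]) (by positivity)
      calc L * (τ * ‖s‖) ^ 2 * ‖s‖ = τ ^ 2 * (L * ‖s‖ ^ 3) := by ring
        _ ≤ _ := this
    linarith
  have := hanti (Set.left_mem_Icc.2 zero_le_one) (Set.right_mem_Icc.2 zero_le_one) zero_le_one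
  simp only [k, one_smul, zero_smul, add_zero] at this
  linarith

/-! ### Regularized quadratic problems -/

theorem eq_zero_and_nonneg_of_quadratic_nonneg {a b : ℝ} (h : ∀ τ : ℝ, 0 ≤ τ * a + τ ^ 2 * b) :
    a = 0 ∧ 0 ≤ b := by
  have ha : a = 0 := by
    by_contra hne
    have hpos : 0 < a ^ 2 := by positivity
    have h1 := h (-a / (|b| + 1))
    have hb : 0 < |b| + 1 := by positivity
    have h2 : -a / (|b| + 1) * a + (-a / (|b| + 1)) ^ 2 * b =
        a ^ 2 / (|b| + 1) ^ 2 * (b - (|b| + 1)) := by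
      field_simp
      ring
    rw [h2] at h1
    have h3 : b - (|b| + 1) < 0 := by linarith [le_abs_self b]
    exact absurd h1 (not_le.2 (mul_neg_of_pos_of_neg (by positivity) h3))
  refine ⟨ha, ?_⟩
  simpa [ha] using h 1

/-- First and second order optimality conditions of a quadratic over a subspace. -/
theorem optimality_of_quadratic_min (K : Submodule ℝ (Vec N)) {A : Vec N →L[ℝ] Vec N}
    (hA : ∀ a b, ⟪a, A b⟫_ℝ = ⟪b, A a⟫_ℝ) {g t : Vec N} (ht : t ∈ K) {lam : ℝ}
    (hmin : ∀ d ∈ K, ⟪g, t⟫_ℝ + 1 / 2 * ⟪t, A t + lam • t⟫_ℝ ≤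
      ⟪g, d⟫_ℝ + 1 / 2 * ⟪d, A d + lam • d⟫_ℝ) {d : Vec N} (hd : d ∈ K) :
    ⟪d, g + (A t + lam • t)⟫_ℝ = 0 ∧ 0 ≤ ⟪d, A d + lam • d⟫_ℝ := by
  have h := eq_zero_and_nonneg_of_quadratic_nonneg (a := ⟪d, g + (A t + lam • t)⟫_ℝ)
    (b := 1 / 2 * ⟪d, A d + lam • d⟫_ℝ) (fun τ => by
      have h1 := hmin (t + τ • d) (K.add_mem ht (K.smul_mem τ hd))
      have h2 := hA t d
      have h3 := real_inner_comm t d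
      have h4 := real_inner_comm g d
      simp only [inner_add_right, inner_add_left, real_inner_smul_left, real_inner_smul_right,
        map_add, map_smul] at h1 ⊢
      rw [h2, h3] at h1
      rw [h3, h4]
      linarith)
  exact ⟨h.1, by linarith [h.2]⟩

/-- Solutions of regularized problems with larger regularization are smaller. -/
theorem inner_le_of_multiplier_lt (K : Submodule ℝ (Vec N)) {A : Vec N →L[ℝ] Vec N}
    {g u₁ u₂ : Vec N} {lam₁ lam₂ : ℝ} (hlt : lam₁ < lam₂) (hmem : u₂ - u₁ ∈ K)
    (h₁ : ∀ d ∈ K, ⟪d, g + (A u₁ + lam₁ • u₁)⟫_ℝ = 0)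
    (h₂ : ∀ d ∈ K, ⟪d, g + (A u₂ + lam₂ • u₂)⟫_ℝ = 0)
    (hp : ∀ d ∈ K, 0 ≤ ⟪d, A d + lam₁ • d⟫_ℝ) :
    ‖u₂‖ ^ 2 ≤ ⟪u₁, u₂⟫_ℝ ∧ ⟪u₁, u₂⟫_ℝ ≤ ‖u₁‖ ^ 2 := by
  have e1 := h₁ _ hmem
  have e2 := h₂ _ hmem
  have p := hp _ hmem
  simp only [inner_add_right, inner_sub_left, inner_sub_right, real_inner_smul_right,
    map_sub, smul_sub, real_inner_self_eq_norm_sq] at e1 e2 p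
  have hc := real_inner_comm u₁ u₂
  have hn : 0 ≤ ‖u₂ - u₁‖ ^ 2 := by positivity
  rw [norm_sub_sq_real] at hn
  rw [hc] at *
  -- With `d = u₂ - u₁`, subtracting the two stationarity conditions gives `⟪d, A d + lam₁ d⟫ +
  -- (lam₂ - lam₁) ⟪d, u₂⟫ = 0`, whose first term is nonnegative.
  have k1 : 0 ≤ (lam₂ - lam₁) * (⟪u₁, u₂⟫_ℝ - ‖u₂‖ ^ 2) := by nlinarith
  have k1' := nonneg_of_mul_nonneg_right k1 (sub_pos.2 hlt)
  constructor <;> linarith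

theorem norm_le_of_multiplier_lt (K : Submodule ℝ (Vec N)) {A : Vec N →L[ℝ] Vec N}
    {g u₁ u₂ : Vec N} {lam₁ lam₂ : ℝ} (hlt : lam₁ < lam₂) (hmem : u₂ - u₁ ∈ K)
    (h₁ : ∀ d ∈ K, ⟪d, g + (A u₁ + lam₁ • u₁)⟫_ℝ = 0)
    (h₂ : ∀ d ∈ K, ⟪d, g + (A u₂ + lam₂ • u₂)⟫_ℝ = 0)
    (hp : ∀ d ∈ K, 0 ≤ ⟪d, A d + lam₁ • d⟫_ℝ) : ‖u₂‖ ≤ ‖u₁‖ := by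
  have h := inner_le_of_multiplier_lt K hlt hmem h₁ h₂ hp
  exact le_of_sq_le_sq (h.1.trans h.2) (norm_nonneg _)

/-- The norm inequality can only be an equality if `u₁ = u₂`, and then the two stationarity
conditions differ by `(lam₂ - lam₁) u₁`. This yields strictness: it contradicts `u₁ ≠ 0` when `K =
⊤`, and the angle condition on `n` and `t` when `K` is the null space of the Jacobian. -/
theorem orthogonal_of_multiplier_lt (K : Submodule ℝ (Vec N)) {A : Vec N →L[ℝ] Vec N}
    {g u₁ u₂ : Vec N} {lam₁ lam₂ : ℝ} (hlt : lam₁ < lam₂) (hmem : u₂ - u₁ ∈ K)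
    (h₁ : ∀ d ∈ K, ⟪d, g + (A u₁ + lam₁ • u₁)⟫_ℝ = 0)
    (h₂ : ∀ d ∈ K, ⟪d, g + (A u₂ + lam₂ • u₂)⟫_ℝ = 0)
    (hp : ∀ d ∈ K, 0 ≤ ⟪d, A d + lam₁ • d⟫_ℝ) (hle : ‖u₁‖ ≤ ‖u₂‖) :
    ∀ d ∈ K, ⟪d, u₁⟫_ℝ = 0 := by
  have h := inner_le_of_multiplier_lt K hlt hmem h₁ h₂ hp
  have hsq : ‖u₁‖ ^ 2 ≤ ‖u₂‖ ^ 2 := pow_le_pow_left₀ (norm_nonneg _) hle 2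
  have heq : u₁ = u₂ := by
    rw [← sub_eq_zero, ← norm_eq_zero, ← sq_eq_zero_iff]
    refine le_antisymm ?_ (by positivity)
    rw [norm_sub_sq_real]
    linarith
  intro d hd
  have e1 := h₁ d hd
  have e2 := h₂ d hd
  rw [← heq] at e2
  simp only [inner_add_right, real_inner_smul_right] at e1 e2
  have : (lam₂ - lam₁) * ⟪d, u₁⟫_ℝ = 0 := by linarith
  exact (mul_eq_zero.1 this).resolve_left (sub_pos.2 hlt).ne'

/-! ### The normal subproblem -/

/-- `n` is stationary for the convex regularized problem `Q^v(lam)`. -/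
def RegSol (c : Vec N → Vec M) (x n : Vec N) (lam : ℝ) : Prop :=
  gv c x + (hess (viol c) x n + lam • n) = 0 ∧
  ∀ d : Vec N, 0 ≤ ⟪d, hess (viol c) x d + lam • d⟫_ℝ

theorem NormalSol.regSol {c : Vec N → Vec M} {x n : Vec N} {δ lam : ℝ}
    (h : NormalSol c x δ n lam) : RegSol c x n lam := ⟨h.2.2.1, h.2.2.2.1⟩

theorem NormalSol.norm_eq {c : Vec N → Vec M} {x n : Vec N} {δ lam : ℝ}
    (h : NormalSol c x δ n lam) (hlam : 0 < lam) : ‖n‖ = δ := by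
  have := (mul_eq_zero.1 h.2.2.2.2.2).resolve_left hlam.ne'
  linarith

theorem QvSol.regSol {c : Vec N → Vec M} (hc : ContDiff ℝ 2 c) {x n : Vec N} {lam : ℝ}
    (h : QvSol c x lam n) : RegSol c x n lam := by
  have key := fun d => optimality_of_quadratic_min (⊤ : Submodule ℝ (Vec N))
    (A := hess (viol c) x) (inner_hess_comm (contDiff_viol hc) x) (g := gv c x) (t := n)
    Submodule.mem_top (lam := lam) (fun d _ => by have := h d; linarith) (d := d) Submodule.mem_top
  exact ⟨inner_self_eq_zero.1 (key _).1, fun d => (key d).2⟩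

theorem RegSol.ne_zero {c : Vec N → Vec M} {x n : Vec N} {lam : ℝ} (h : RegSol c x n lam)
    (hg : gv c x ≠ 0) : n ≠ 0 := by
  rintro rfl
  exact hg (by simpa using h.1)

theorem RegSol.norm_lt {c : Vec N → Vec M} {x n₁ n₂ : Vec N} {lam₁ lam₂ : ℝ}
    (hg : gv c x ≠ 0) (h₁ : RegSol c x n₁ lam₁) (h₂ : RegSol c x n₂ lam₂) (hlt : lam₁ < lam₂) :
    ‖n₂‖ < ‖n₁‖ := by
  by_contra! hle
  have := orthogonal_of_multiplier_lt (⊤ : Submodule ℝ (Vec N)) hlt Submodule.mem_top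
    (fun d _ => by rw [h₁.1, inner_zero_right]) (fun d _ => by rw [h₂.1, inner_zero_right])
    (fun d _ => h₁.2 d) hle n₁ Submodule.mem_top
  exact h₁.ne_zero hg (inner_self_eq_zero.1 this)

theorem RegSol.multiplier_eq {c : Vec N → Vec M} {x n : Vec N} {lam₁ lam₂ : ℝ}
    (hg : gv c x ≠ 0) (h₁ : RegSol c x n lam₁) (h₂ : RegSol c x n lam₂) : lam₁ = lam₂ := by
  rcases lt_trichotomy lam₁ lam₂ with h | h | h
  · exact absurd (h₁.norm_lt hg h₂ h) (lt_irrefl _)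
  · exact h
  · exact absurd (h₂.norm_lt hg h₁ h) (lt_irrefl _)

/-- A solution of the regularized problem determines the trust region solution of its radius. -/
theorem NormalSol.eq_of_regSol {c : Vec N → Vec M} {x n nhat : Vec N} {lam lamhat : ℝ}
    (hg : gv c x ≠ 0) (hhat : RegSol c x nhat lamhat) (hpos : 0 < lamhat)
    (h : NormalSol c x ‖nhat‖ n lam) : lam = lamhat ∧ ‖n‖ = ‖nhat‖ := by
  have hl : lam = lamhat := by
    rcases lt_trichotomy lam lamhat with hlt | heq | hgt
    · exact absurd (h.regSol.norm_lt hg hhat hlt) (not_lt.2 h.1)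
    · exact heq
    · have := hhat.norm_lt hg h.regSol hgt
      rw [h.norm_eq (hpos.trans hgt)] at this
      exact absurd this (lt_irrefl _)
  exact ⟨hl, h.norm_eq (hl ▸ hpos)⟩

/-- A larger multiplier at the larger radius would be positive, so its solution would lie on the
boundary, yet be strictly shorter than `n`. -/
theorem NormalSol.multiplier_le {c : Vec N → Vec M} {x n n' : Vec N} {δ δ' lam lam' : ℝ}
    (hg : gv c x ≠ 0) (h : NormalSol c x δ n lam) (h' : NormalSol c x δ' n' lam') (hle : δ ≤ δ') :
    lam' ≤ lam := by
  by_contra! hlt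
  have h1 := h.regSol.norm_lt hg h'.regSol hlt
  rw [h'.norm_eq (h.2.2.2.2.1.trans_lt hlt)] at h1
  linarith [h.1]

theorem NormalSol.decrease {c : Vec N → Vec M} {x n : Vec N} {δ lam : ℝ}
    (h : NormalSol c x δ n lam) : 1 / 2 * lam * ‖n‖ ^ 2 ≤ mv c x 0 - mv c x n := by
  have h1 : ⟪n, gv c x + (hess (viol c) x n + lam • n)⟫_ℝ = 0 := by
    rw [h.2.2.1, inner_zero_right]
  have h2 := h.2.2.2.1 n
  simp only [inner_add_right, real_inner_smul_right, real_inner_self_eq_norm_sq] at h1 h2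
  rw [real_inner_comm] at h1
  simp only [mv, inner_zero_right, inner_zero_left]
  linarith

/-- Explains the shift `r = √(σ ‖gv‖)`: the Hessian is already semidefinite after adding `lam`, so
`r ‖nhat‖ ≤ ‖gv‖`, and multiplying by `σ` gives `σ ‖nhat‖ ≤ r`. -/
theorem RegSol.le_ratio {c : Vec N → Vec M} {x n nhat : Vec N} {lam σ : ℝ} (hσ : 0 < σ)
    (h : RegSol c x n lam) (hlam : 0 ≤ lam) (hg : gv c x ≠ 0)
    (hhat : RegSol c x nhat (lam + Real.sqrt (σ * ‖gv c x‖))) :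
    σ * ‖nhat‖ ≤ lam + Real.sqrt (σ * ‖gv c x‖) := by
  set r := Real.sqrt (σ * ‖gv c x‖)
  have hr0 : 0 ≤ r := Real.sqrt_nonneg _
  have hr : r ^ 2 = σ * ‖gv c x‖ := Real.sq_sqrt (by positivity)
  have h1 : ⟪nhat, gv c x + (hess (viol c) x nhat + (lam + r) • nhat)⟫_ℝ = 0 := by
    rw [hhat.1, inner_zero_right]
  have h2 := h.2 nhat
  simp only [inner_add_right, real_inner_smul_right, real_inner_self_eq_norm_sq] at h1 h2
  have h3 := abs_real_inner_le_norm nhat (gv c x)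
  have h4 := (abs_le.1 h3).1
  have hn : 0 < ‖nhat‖ := norm_pos_iff.2 (hhat.ne_zero hg)
  have h5 : r * ‖nhat‖ ≤ ‖gv c x‖ := by
    have : ‖nhat‖ * (r * ‖nhat‖) ≤ ‖nhat‖ * ‖gv c x‖ := by nlinarith
    exact le_of_mul_le_mul_left this hn
  have hrpos : 0 < r := Real.sqrt_pos.2 (mul_pos hσ (norm_pos_iff.2 hg))
  have h6 : r * (σ * ‖nhat‖) ≤ r * r := by
    calc r * (σ * ‖nhat‖) = σ * (r * ‖nhat‖) := by ring
      _ ≤ σ * ‖gv c x‖ := mul_le_mul_of_nonneg_left h5 hσ.le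
      _ = r * r := by rw [← hr]; ring
  linarith [le_of_mul_le_mul_left h6 hrpos]

/-- Effect of a contraction on the next solution of the normal subproblem. -/
theorem VContract.next {P : Params} {c : Vec N → Vec M} (hc : ContDiff ℝ 2 c) {D : Iter N}
    {r τ lam' : ℝ} {n' : Vec N} (hg : gv c D.x ≠ 0) (hn : NormalSol c D.x D.δv D.n D.lamv)
    (hn' : NormalSol c D.x r n' lam') (h : VContract P c D r) (hτ : D.lamv ≤ τ * ‖D.n‖) :
    r ≤ D.δv ∧ P.σlo * ‖n'‖ ≤ lam' ∧ lam' ≤ max P.σhi (P.γlam / P.γc * τ) * ‖n'‖ ∧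
      ∀ θ, θ * ‖D.n‖ ≤ D.lamv → P.σlo * ‖D.n‖ ≤ D.lamv →
        θ * min P.γlam P.γc⁻¹ * ‖n'‖ ≤ lam' := by
  have hnpos : 0 < ‖D.n‖ := norm_pos_iff.2 (hn.regSol.ne_zero hg)
  have hσlo := P.σlo_pos
  have hc0 := P.γc_mem.1
  have hc1 := P.γc_mem.2
  have hlam1 := P.one_lt_γlam
  have hlam0 : 0 ≤ D.lamv := hn.2.2.2.2.1
  rcases h with ⟨hlt, nhat, hhat, hcase⟩ | ⟨hge, nhat, hhat, hcase⟩
  · have hr : 0 < Real.sqrt (P.σlo * ‖gv c D.x‖) :=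
      Real.sqrt_pos.2 (mul_pos hσlo (norm_pos_iff.2 hg))
    obtain ⟨lam, m, hlam, hm, hlo, hhi, hrm⟩ : ∃ (lam : ℝ) (m : Vec N), D.lamv < lam ∧
        RegSol c D.x m lam ∧ P.σlo * ‖m‖ ≤ lam ∧ lam ≤ P.σhi * ‖m‖ ∧ r = ‖m‖ := by
      rcases hcase with ⟨hle, hrm⟩ | ⟨-, lam, m, hmem, hm, hlo, hhi, hrm⟩
      · have hreg := hhat.regSol hc
        have hpos : 0 < ‖nhat‖ := norm_pos_iff.2 (hreg.ne_zero hg)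
        exact ⟨_, nhat, by linarith, hreg, hn.regSol.le_ratio hσlo hlam0 hg hreg,
          (div_le_iff₀ hpos).1 hle, hrm⟩
      · have hreg := hm.regSol hc
        have hpos : 0 < ‖m‖ := norm_pos_iff.2 (hreg.ne_zero hg)
        exact ⟨lam, m, hmem.1, hreg, (le_div_iff₀ hpos).1 hlo, (div_le_iff₀ hpos).1 hhi, hrm⟩
    subst hrm
    obtain ⟨e1, e2⟩ := hn'.eq_of_regSol hg hm (hlam0.trans_lt hlam)
    rw [e1, e2]
    exact ⟨(hn.regSol.norm_lt hg hm hlam).le.trans hn.1, hlo,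
      hhi.trans (mul_le_mul_of_nonneg_right (le_max_left _ _) (norm_nonneg _)),
      fun θ _ hθ => absurd hθ (not_le.2 hlt)⟩
  · have hlampos : 0 < D.lamv := (mul_pos hσlo hnpos).trans_le hge
    have hreg := hhat.regSol hc
    have hll : D.lamv < P.γlam * D.lamv := by nlinarith
    have hlt := hn.regSol.norm_lt hg hreg hll
    -- Either the multiplier grows by exactly `γlam` while the norm does not grow, or the norm
    -- shrinks by `γc` while the multiplier does not drop; both raise the ratio by at least `min
    -- γlam γc⁻¹`. The upper bounds lose at most `γlam / γc`.
    obtain ⟨hlamle, hlamge, hnge, hrle, hgrow⟩ : lam' ≤ P.γlam * D.lamv ∧ D.lamv ≤ lam' ∧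
        P.γc * ‖D.n‖ ≤ ‖n'‖ ∧ r ≤ D.δv ∧ ((lam' = P.γlam * D.lamv ∧ ‖n'‖ ≤ ‖D.n‖) ∨
          ‖n'‖ ≤ P.γc * ‖D.n‖) := by
      rcases hcase with ⟨hge', hr⟩ | ⟨hlt', hr⟩
      · subst hr
        obtain ⟨e1, e2⟩ := hn'.eq_of_regSol hg hreg (hlampos.trans hll)
        rw [e1, e2]
        exact ⟨le_rfl, hll.le, hge', hlt.le.trans hn.1, Or.inl ⟨rfl, hlt.le⟩⟩
      · subst hr
        have hsmall : P.γc * ‖D.n‖ < ‖D.n‖ := by nlinarith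
        have h1 : D.lamv ≤ lam' :=
          hn'.multiplier_le hg hn (hsmall.le.trans hn.1)
        have e := hn'.norm_eq (hlampos.trans_le h1)
        refine ⟨?_, h1, e.ge, hsmall.le.trans hn.1, Or.inr e.le⟩
        by_contra! hgt
        have := hreg.norm_lt hg hn'.regSol hgt
        rw [e] at this
        exact hlt' this.le
    have hn'pos : 0 < ‖n'‖ := (mul_pos hc0 hnpos).trans_le hnge
    have hmain : ∀ θ, 0 ≤ θ → θ * ‖D.n‖ ≤ D.lamv →
        θ * min P.γlam P.γc⁻¹ * ‖n'‖ ≤ lam' := by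
      intro θ h0 hθ
      rcases hgrow with ⟨e, hle⟩ | hle
      · calc θ * min P.γlam P.γc⁻¹ * ‖n'‖ ≤ θ * P.γlam * ‖D.n‖ :=
            mul_le_mul (mul_le_mul_of_nonneg_left (min_le_left _ _) h0) hle (norm_nonneg _)
              (by positivity)
          _ = P.γlam * (θ * ‖D.n‖) := by ring
          _ ≤ P.γlam * D.lamv := mul_le_mul_of_nonneg_left hθ (by linarith)
          _ = lam' := e.symm
      · calc θ * min P.γlam P.γc⁻¹ * ‖n'‖ ≤ θ * P.γc⁻¹ * (P.γc * ‖D.n‖) :=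
            mul_le_mul (mul_le_mul_of_nonneg_left (min_le_right _ _) h0) hle (norm_nonneg _)
              (by positivity)
          _ = θ * ‖D.n‖ := by field_simp
          _ ≤ lam' := hθ.trans hlamge
    refine ⟨hrle, ?_, ?_, fun θ hθ _ => ?_⟩
    · have hmin : 1 ≤ min P.γlam P.γc⁻¹ := le_min hlam1.le ((one_le_inv₀ hc0).2 hc1.le)
      refine le_trans ?_ (hmain P.σlo hσlo.le hge)
      exact mul_le_mul_of_nonneg_right (by nlinarith) (norm_nonneg _)
    · have hτ0 : 0 < τ := by
        by_contra! h0
        nlinarith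
      refine le_trans ?_ (mul_le_mul_of_nonneg_right (le_max_right _ _) (norm_nonneg _))
      calc lam' ≤ P.γlam * (τ * ‖D.n‖) :=
            hlamle.trans (mul_le_mul_of_nonneg_left hτ (by linarith))
        _ = P.γlam / P.γc * τ * (P.γc * ‖D.n‖) := by field_simp
        _ ≤ P.γlam / P.γc * τ * ‖n'‖ := mul_le_mul_of_nonneg_left hnge (by positivity)
    · rcases le_total 0 θ with h0 | h0
      · exact hmain θ h0 hθ
      · have hmin : 0 < min P.γlam P.γc⁻¹ := lt_min (by linarith) (inv_pos.2 hc0)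
        have : θ * min P.γlam P.γc⁻¹ * ‖n'‖ ≤ 0 :=
          mul_nonpos_of_nonpos_of_nonneg (mul_nonpos_of_nonpos_of_nonneg h0 hmin.le)
            (norm_nonneg _)
        linarith

/-! ### The full step -/

theorem ComputeSteps.cases {P : Params} {f : Vec N → ℝ} {c : Vec N → Vec M} {D : Iter N}
    (h : ComputeSteps P f c D) : D.t = 0 ∨
      (TangSol f c D.x D.H D.n (D.δs P) D.t D.lamf ∧ KeepTang P c D.x D.n D.t) := by
  by_cases ht : TryTang P f c D
  · obtain ⟨t, lam, hsol, ⟨hk, rfl, rfl⟩ | ⟨-, h0, -⟩⟩ := h.2.1 ht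
    · exact Or.inr ⟨hsol, hk⟩
    · exact Or.inl h0
  · exact Or.inl (h.2.2 ht).1

theorem Iter.s_of_t_eq_zero {D : Iter N} (h : D.t = 0) : D.s = D.n := by
  simp [Iter.s, h]

theorem ComputeSteps.le_norm_s {P : Params} {f : Vec N → ℝ} {c : Vec N → Vec M} {D : Iter N}
    (h : ComputeSteps P f c D) : P.κtn * ‖D.n‖ ≤ ‖D.s‖ := by
  rcases h.cases with h0 | ⟨-, hk⟩
  · rw [Iter.s_of_t_eq_zero h0]
    nlinarith [P.κtn_mem.2, norm_nonneg D.n]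
  · exact hk.2.1

theorem ComputeSteps.norm_s_pos {P : Params} {f : Vec N → ℝ} {c : Vec N → Vec M} {D : Iter N}
    (h : ComputeSteps P f c D) (hg : gv c D.x ≠ 0) : 0 < ‖D.s‖ :=
  (mul_pos P.κtn_mem.1 (norm_pos_iff.2 (h.1.regSol.ne_zero hg))).trans_le h.le_norm_s

theorem ComputeSteps.norm_s_le {P : Params} {f : Vec N → ℝ} {c : Vec N → Vec M} {D : Iter N}
    (h : ComputeSteps P f c D) : ‖D.s‖ ≤ P.κδ * D.δv := by
  rcases h.cases with h0 | ⟨hs, -⟩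
  · rw [Iter.s_of_t_eq_zero h0]
    nlinarith [P.one_lt_κδ, norm_nonneg D.n, h.1.1]
  · exact hs.2.1.trans (min_le_left _ _)

theorem ComputeSteps.decrease {P : Params} {f : Vec N → ℝ} {c : Vec N → Vec M} {D : Iter N}
    (h : ComputeSteps P f c D) :
    P.κvm * (1 / 2 * D.lamv * ‖D.n‖ ^ 2) ≤ mv c D.x 0 - mv c D.x D.s := by
  have hd := h.1.decrease
  have hk0 := P.κvm_mem.1
  have hk1 := P.κvm_mem.2
  have h1 := mul_le_mul_of_nonneg_left hd hk0.le
  rcases h.cases with h0 | ⟨-, hk⟩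
  · rw [Iter.s_of_t_eq_zero h0]
    have : 0 ≤ 1 / 2 * D.lamv * ‖D.n‖ ^ 2 :=
      mul_nonneg (mul_nonneg (by norm_num) h.1.2.2.2.2.1) (by positivity)
    nlinarith
  · exact h1.trans hk.1

theorem ComputeSteps.norm_hess_t_le {P : Params} {f : Vec N → ℝ} {c : Vec N → Vec M}
    {D : Iter N} (h : ComputeSteps P f c D) :
    ‖hess (viol c) D.x D.t‖ ≤ P.κht * ‖D.s‖ ^ 2 := by
  rcases h.cases with h0 | ⟨-, hk⟩
  · rw [h0, map_zero, norm_zero]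
    have := P.κht_pos
    positivity
  · exact hk.2.2

/-- The model predicts a decrease of at least `κvm * lamv * ‖n‖ ^ 2 / 2`, while a failed step and
Taylor's bound limit it by `(L / 2 + κρ) ‖s‖ ^ 3`. When `lamv > 0` the normal step is on the
boundary, so `‖s‖ ≤ κδ ‖n‖`. -/
theorem multiplier_le_of_rhoV_lt {P : Params} {f : Vec N → ℝ} {c : Vec N → Vec M} {D : Iter N}
    {L : ℝ} (hc : ContDiff ℝ 2 c) (hL : 0 ≤ L) (hg : gv c D.x ≠ 0) (h : ComputeSteps P f c D)
    (hlip : HessLipOn (viol c) L D.x D.s) (hr : rhoV c D < P.κρ) :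
    D.lamv ≤ P.κδ ^ 3 / P.κvm * (L + 2 * P.κρ) * ‖D.n‖ := by
  have hρ := P.κρ_mem.1
  have hvm := P.κvm_mem.1
  have hδ : 0 < P.κδ := by linarith [P.one_lt_κδ]
  have hnpos : 0 < ‖D.n‖ := norm_pos_iff.2 (h.1.regSol.ne_zero hg)
  rcases h.1.2.2.2.2.1.eq_or_lt with h0 | hpos
  · rw [← h0]
    positivity
  have hs := h.norm_s_pos hg
  rw [rhoV, div_lt_iff₀ (by positivity)] at hr
  have ht := le_quadratic_add_cube (contDiff_viol hc) hL hlip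
  rw [gradient_viol_eq hc] at ht
  have hd := h.decrease
  simp only [mv, inner_zero_right, inner_zero_left] at hd
  have hle := h.norm_s_le
  rw [← h.1.norm_eq hpos] at hle
  have hcube : ‖D.s‖ ^ 3 ≤ (P.κδ * ‖D.n‖) ^ 3 := pow_le_pow_left₀ hs.le hle 3
  have h1 : P.κvm * D.lamv * ‖D.n‖ ^ 2 ≤ (L + 2 * P.κρ) * (P.κδ * ‖D.n‖) ^ 3 := by
    have := mul_le_mul_of_nonneg_left hcube (show 0 ≤ L + 2 * P.κρ by positivity)
    linarith
  have h2 : D.lamv * (P.κvm * ‖D.n‖ ^ 2) ≤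
      P.κδ ^ 3 / P.κvm * (L + 2 * P.κρ) * ‖D.n‖ * (P.κvm * ‖D.n‖ ^ 2) := by
    calc D.lamv * (P.κvm * ‖D.n‖ ^ 2) = P.κvm * D.lamv * ‖D.n‖ ^ 2 := by ring
      _ ≤ _ := h1
      _ = _ := by field_simp
  exact le_of_mul_le_mul_right h2 (by positivity)

theorem norm_gv_add_le {P : Params} {f : Vec N → ℝ} {c : Vec N → Vec M} {D : Iter N} {L σ : ℝ}
    (hc : ContDiff ℝ 2 c) (hL : 0 ≤ L) (h : ComputeSteps P f c D)
    (hlip : HessLipOn (viol c) L D.x D.s) (hσ0 : 0 ≤ σ) (hσ : D.lamv ≤ σ * ‖D.n‖) :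
    ‖gv c (D.x + D.s)‖ ≤ (L + P.κht + σ / P.κtn ^ 2) * ‖D.s‖ ^ 2 := by
  have htn := P.κtn_mem.1
  have h1 := norm_gradient_sub_le (contDiff_viol hc) hL hlip
  rw [gradient_viol_eq hc, gradient_viol_eq hc] at h1
  have h2 := h.norm_hess_t_le
  have h3 : ‖D.lamv • D.n‖ ≤ σ / P.κtn ^ 2 * ‖D.s‖ ^ 2 := by
    rw [norm_smul, Real.norm_of_nonneg h.1.2.2.2.2.1]
    calc D.lamv * ‖D.n‖ ≤ σ * ‖D.n‖ * ‖D.n‖ := mul_le_mul_of_nonneg_right hσ (norm_nonneg _)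
      _ = σ / P.κtn ^ 2 * (P.κtn * ‖D.n‖) ^ 2 := by field_simp
      _ ≤ σ / P.κtn ^ 2 * ‖D.s‖ ^ 2 := by
        have := h.le_norm_s
        gcongr
  -- Stationarity of `n` removes the gradient at `x`; the Taylor remainder, the Hessian on `t` and
  -- the multiplier term remain, and give the three summands of the constant.
  have h4 : gv c (D.x + D.s) = (gv c (D.x + D.s) - gv c D.x - hess (viol c) D.x D.s) +
      hess (viol c) D.x D.t - D.lamv • D.n := by
    have := h.1.2.2.1
    rw [← sub_eq_zero]
    rw [← this, Iter.s, map_add]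
    abel
  rw [h4]
  refine (norm_sub_le _ _).trans ((add_le_add_left (norm_add_le _ _) _).trans ?_)
  linarith

/-! ### F-iterations -/

theorem TangSol.inner_eq_zero {f : Vec N → ℝ} {c : Vec N → Vec M} {x n t : Vec N}
    {H : Vec N →L[ℝ] Vec N} {δ lam : ℝ} (h : TangSol f c x H n δ t lam) {d : Vec N}
    (hd : jac c x d = 0) : ⟪d, gradient f x + (H (n + t) + lam • (n + t))⟫_ℝ = 0 := by
  obtain ⟨y, hy⟩ := h.2.2.2.1
  have : gradient f x + (H (n + t) + lam • (n + t)) =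
      -ContinuousLinearMap.adjoint (jac c x) y := by
    rw [map_add, smul_add]
    rw [eq_neg_iff_add_eq_zero] at hy ⊢
    rw [← hy]
    abel
  rw [this, inner_neg_right, ContinuousLinearMap.adjoint_inner_right, hd, inner_zero_left,
    neg_zero]

theorem inner_comm_of_isSelfAdjoint {H : Vec N →L[ℝ] Vec N} (hH : IsSelfAdjoint H)
    (a b : Vec N) : ⟪a, H b⟫_ℝ = ⟪b, H a⟫_ℝ := by
  rw [real_inner_comm, ← ContinuousLinearMap.adjoint_inner_right,
    ContinuousLinearMap.isSelfAdjoint_iff'.1 hH]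

theorem QfSol.inner_eq_zero {f : Vec N → ℝ} {c : Vec N → Vec M} {x n t : Vec N}
    {H : Vec N →L[ℝ] Vec N} (hH : IsSelfAdjoint H) {lam : ℝ} (h : QfSol f c x H n lam t)
    {d : Vec N} (hd : jac c x d = 0) :
    ⟪d, gradient f x + (H (n + t) + lam • (n + t))⟫_ℝ = 0 := by
  have key := optimality_of_quadratic_min (LinearMap.ker (jac c x : Vec N →ₗ[ℝ] Vec M))
    (A := H) (inner_comm_of_isSelfAdjoint hH)
    (g := gradient f x + (H n + lam • n)) (t := t) h.1 (lam := lam)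
    (fun d hd => h.2 d hd) (d := d) hd
  rw [← key.1, map_add, smul_add]
  congr 1
  abel

theorem IsF.tangSol {P : Params} {f : Vec N → ℝ} {c : Vec N → Vec M} {D : Iter N}
    (hF : IsF P f c D) (h : ComputeSteps P f c D) :
    TangSol f c D.x D.H D.n (D.δs P) D.t D.lamf :=
  (h.cases.resolve_left hF.1.1).1

/-- Objective analogue of the bound for failed V-steps. The tangential decrease passes to the whole
step through `κfm`, `‖t‖` to `‖s‖` through `κst`, and replacing the Hessian by `H` costs `κhs`. -/
theorem multiplier_lt_of_rhoF_lt {P : Params} {f : Vec N → ℝ} {c : Vec N → Vec M} {D : Iter N}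
    {L : ℝ} (hf : ContDiff ℝ 2 f) (hL : 0 ≤ L) (hsa : IsSelfAdjoint D.H) (hg : gv c D.x ≠ 0) (h : ComputeSteps P f c D)
    (hF : IsF P f c D) (hlip : HessLipOn f L D.x D.s) (hr : rhoF f D < P.κρ) :
    D.lamf * (P.κfm * P.κst ^ 2 * (1 - P.κntt)) < (P.κhs + L + 2 * P.κρ) * ‖D.s‖ := by
  have hfm := P.κfm_mem.1
  have hst := P.κst_mem.1
  have hntt := P.κntt_mem.2
  have hs := h.norm_s_pos hg
  have hsol := hF.tangSol h
  obtain ⟨⟨-, hts⟩, hdec, -, hnt, -, hH⟩ := hF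
  have hlam := hsol.2.2.2.2.2.1
  rw [rhoF, div_lt_iff₀ (by positivity)] at hr
  have ht := le_quadratic_add_cube hf hL hlip
  have e1 := hsol.inner_eq_zero hsol.1
  have e2 := hsol.2.2.2.2.1 D.t hsol.1
  -- Stationarity tested with `t` turns the decrease into `½⟪t, H t + lamf t⟫ + lamf ⟪n, t⟫ + ½ lamf
  -- ‖t‖²`; the angle condition absorbs the cross term.
  have hmod : 1 / 2 * D.lamf * (1 - P.κntt) * ‖D.t‖ ^ 2 ≤
      mf f D.x D.H D.n - mf f D.x D.H D.s := by
    have e3 := inner_comm_of_isSelfAdjoint hsa D.n D.t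
    have e4 := real_inner_comm (gradient f D.x) D.t
    have e5 := real_inner_comm D.n D.t
    have e6 := mul_le_mul_of_nonneg_left hnt hlam
    simp only [mf, Iter.s, map_add, inner_add_left, inner_add_right, real_inner_smul_right,
      smul_add, real_inner_self_eq_norm_sq] at e1 e2 e6 ⊢
    rw [e5] at e1
    linarith
  have hst2 : (P.κst * ‖D.s‖) ^ 2 ≤ ‖D.t‖ ^ 2 := pow_le_pow_left₀ (by positivity) hts 2
  have h1 : 1 / 2 * D.lamf * (1 - P.κntt) * (P.κst * ‖D.s‖) ^ 2 ≤
      1 / 2 * D.lamf * (1 - P.κntt) * ‖D.t‖ ^ 2 :=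
    mul_le_mul_of_nonneg_left hst2 (mul_nonneg (by positivity) (by linarith))
  have h2 := mul_le_mul_of_nonneg_left (h1.trans hmod) hfm.le
  have h3 : -⟪D.s, (D.H - hess f D.x) D.s⟫_ℝ ≤ P.κhs * ‖D.s‖ ^ 3 := by
    have a1 := (abs_le.1 (abs_real_inner_le_norm D.s ((D.H - hess f D.x) D.s))).1
    have a2 := mul_le_mul_of_nonneg_left hH hs.le
    nlinarith
  rw [_root_.sub_apply, inner_sub_right] at h3
  have h4 : mf f D.x D.H 0 - mf f D.x D.H D.s =
      -⟪gradient f D.x, D.s⟫_ℝ - 1 / 2 * ⟪D.s, D.H D.s⟫_ℝ := by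
    simp only [mf, inner_zero_right, inner_zero_left]
    ring
  have h5 : D.lamf * (P.κfm * P.κst ^ 2 * (1 - P.κntt)) * ‖D.s‖ ^ 2 <
      (P.κhs + L + 2 * P.κρ) * ‖D.s‖ * ‖D.s‖ ^ 2 := by
    have h6 : D.lamf * (P.κfm * P.κst ^ 2 * (1 - P.κntt)) * ‖D.s‖ ^ 2 =
        2 * (P.κfm * (1 / 2 * D.lamf * (1 - P.κntt) * (P.κst * ‖D.s‖) ^ 2)) := by ring
    rw [h6]
    have h7 : (P.κhs + L + 2 * P.κρ) * ‖D.s‖ * ‖D.s‖ ^ 2 =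
      (P.κhs + L + 2 * P.κρ) * ‖D.s‖ ^ 3 := by ring
    rw [h7]
    linarith
  exact lt_of_mul_lt_mul_right h5 (by positivity)

/-- Effect of a contraction in an F-iteration on the next F-iteration. -/
theorem FContract.next {P : Params} {f : Vec N → ℝ} {c : Vec N → Vec M} {D D' : Iter N}
    (hH : IsSelfAdjoint D.H) (hs : 0 < ‖D.s‖) (h : ComputeSteps P f c D) (hF : IsF P f c D)
    (h' : ComputeSteps P f c D') (hF' : IsF P f c D') (hx : D'.x = D.x) (hn : D'.n = D.n)
    (hHH : D'.H = D.H) (hcon : FContract P f c D D'.δf) :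
    P.σlo * ‖D'.s‖ ≤ D'.lamf ∧ (P.σlo * ‖D.s‖ ≤ D.lamf →
      ∀ θ, 0 ≤ θ → θ * ‖D.s‖ ≤ D.lamf → θ * P.γc⁻¹ * ‖D'.s‖ ≤ D'.lamf) := by
  have hσ := P.σlo_pos
  have hc0 := P.γc_mem.1
  have hc1 := P.γc_mem.2
  have hsol := hF.tangSol h
  have hsol' := hF'.tangSol h'
  rw [hx, hn, hHH] at hsol'
  have hs' : ‖D'.s‖ = ‖D.n + D'.t‖ := by rw [Iter.s, hn]
  have hle' : ‖D'.s‖ ≤ D'.δf := by rw [hs']; exact hsol'.2.1.trans (min_le_right _ _)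
  set K := LinearMap.ker (jac c D.x : Vec N →ₗ[ℝ] Vec M)
  rcases hcon with ⟨hlt, lam, t, hlam, hq, hratio, hr⟩ | ⟨hge, hr⟩
  · have hupos : 0 < ‖D.n + t‖ := by
      rcases (norm_nonneg (D.n + t)).eq_or_lt with h0 | h0
      · rw [← h0, div_zero] at hratio
        linarith
      · exact h0
    refine ⟨?_, fun h0 => absurd h0 (not_le.2 hlt)⟩
    -- Otherwise the new step, no longer than `n + t`, would be orthogonal to the null space; tested
    -- with the new tangential step this gives `⟪n, t'⟫ = -‖t'‖²`, against the angle condition of an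
    -- F-iteration.
    have hlam' : lam ≤ D'.lamf := by
      by_contra! hcon
      have := orthogonal_of_multiplier_lt K (A := D.H) (g := gradient f D.x)
        (u₁ := D.n + D'.t) (u₂ := D.n + t) hcon
        (by
          rw [add_sub_add_left_eq_sub]
          exact K.sub_mem (show t ∈ K from hq.1) (show D'.t ∈ K from hsol'.1))
        (fun d hd => hsol'.inner_eq_zero hd) (fun d hd => hq.inner_eq_zero hH hd)
        (fun d hd => hsol'.2.2.2.2.1 d hd) (by rw [← hs', ← hr]; exact hle')
        D'.t hsol'.1
      rw [inner_add_right, real_inner_self_eq_norm_sq, real_inner_comm] at this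
      have h1 := hF'.2.2.2.1
      rw [hn] at h1
      have h2 : 0 < ‖D'.t‖ := norm_pos_iff.2 hF'.1.1
      have h3 : 0 < ‖D'.t‖ ^ 2 := by positivity
      nlinarith [P.κntt_mem.2]
    calc P.σlo * ‖D'.s‖ ≤ P.σlo * ‖D.n + t‖ := by
          rw [hr] at hle'
          exact mul_le_mul_of_nonneg_left hle' hσ.le
      _ ≤ lam := (le_div_iff₀ hupos).1 hratio
      _ ≤ D'.lamf := hlam'
  · rw [hr] at hle'
    have hlam' : D.lamf ≤ D'.lamf := by
      by_contra! hcon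
      have hcase : ‖D.n + D.t‖ ≤ ‖D.n + D'.t‖ := norm_le_of_multiplier_lt K (A := D.H)
        (g := gradient f D.x) hcon
        (by
          rw [add_sub_add_left_eq_sub]
          exact K.sub_mem (show D.t ∈ K from hsol.1) (show D'.t ∈ K from hsol'.1))
        (fun d hd => hsol'.inner_eq_zero hd) (fun d hd => hsol.inner_eq_zero hd)
        (fun d hd => hsol'.2.2.2.2.1 d hd)
      rw [← hs', ← Iter.s] at hcase
      nlinarith
    have key : ∀ θ, 0 ≤ θ → θ * ‖D.s‖ ≤ D.lamf → θ * P.γc⁻¹ * ‖D'.s‖ ≤ D'.lamf := by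
      intro θ h0 hθ
      calc θ * P.γc⁻¹ * ‖D'.s‖ ≤ θ * P.γc⁻¹ * (P.γc * ‖D.s‖) :=
            mul_le_mul_of_nonneg_left hle' (by positivity)
        _ = θ * ‖D.s‖ := by field_simp
        _ ≤ D'.lamf := hθ.trans hlam'
    refine ⟨?_, fun _ => key⟩
    refine le_trans ?_ (key P.σlo hσ.le hge)
    have : 1 ≤ P.γc⁻¹ := (one_le_inv₀ hc0).2 hc1.le
    exact mul_le_mul_of_nonneg_right (by nlinarith) (norm_nonneg _)

/-! ### Counting iterations -/

/-- Thresholds used to count iterations: `α`, `β` bound from below the decrease of the funnel radius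
in accepted steps, `Bc` and `Bf` bound the number of contractions in V- and F-iterations. -/
structure CountBounds (P : Params) (Lv Lf Δ ε α β : ℝ) (Bc Bf : ℕ) : Prop where
  α_le : ∀ r : ℝ, 0 ≤ r → ε ≤ (Lv + P.κht + sigmaMax P Lv / P.κtn ^ 2) * r ^ 2 →
    α ≤ P.κρ * (1 - P.κv2) * r ^ 3
  β_le : β ≤ P.κρ * (1 - P.κv2) * (P.κtn * Δ) ^ 3
  le_Bc : ∀ j : ℕ, P.σlo * min P.γlam P.γc⁻¹ ^ j ≤ sigmaMax P Lv → j + 1 ≤ Bc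
  one_le_Bf : 1 ≤ Bf
  le_Bf : ∀ j : ℕ, P.σlo * P.γc⁻¹ ^ j * (P.κfm * P.κst ^ 2 * (1 - P.κntt)) <
    P.κhs + Lf + 2 * P.κρ → j + 2 ≤ Bf

/-- The invariant of the method at the beginning of iteration `k`: `a₁` and `a₂` count accepted
steps, and since the last of them there were `e` expansions, `m` contractions in V-iterations and,
since the last of these, `l` rejected F-iterations. -/
structure CountInv (P : Params) (f : Vec N → ℝ) (c : Vec N → Vec M) (Lv V Δ α β : ℝ) (Bc Bf : ℕ)
    (D : Iter N) (k a₁ a₂ e m l : ℕ) : Prop where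
  count : k ≤ (a₁ + a₂) * (1 + (Bc + 1) * (Bf + 1)) + e + m * (Bf + 1) + l
  e_le : e ≤ 1
  l_le : l ≤ Bf
  no_expand : 0 < e + m + l → D.lamv ≤ D.σ * ‖D.n‖ ∨ ‖D.n‖ = D.δmax
  ratio_le : 0 < m + l → D.lamv ≤ D.σ * ‖D.n‖
  le_ratio : ∀ j, m = j + 1 → P.σlo * min P.γlam P.γc⁻¹ ^ j * ‖D.n‖ ≤ D.lamv
  le_ratioF : ∀ j, l = j + 1 → IsF P f c D → P.σlo * P.γc⁻¹ ^ j * ‖D.s‖ ≤ D.lamf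
  decrease : a₁ * α + a₂ * β ≤ V - D.vmax
  σ_mem : D.σ ∈ Set.Icc P.σlo (sigmaMax P Lv)
  δv_le : D.δv ≤ D.δmax
  le_δmax : Δ ≤ D.δmax
  viol_le : viol c D.x ≤ D.vmax

theorem performed_of_succ {c : Vec N → Vec M} {ε : ℝ} {R : ℕ → Iter N} {k : ℕ}
    (h : k + 1 ∈ performed c ε R) : k ∈ performed c ε R :=
  fun j hj => h j (by omega)

theorem gv_ne_zero_of_performed {c : Vec N → Vec M} {ε : ℝ} (hε : 0 < ε) {R : ℕ → Iter N} {k : ℕ}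
    (h : k ∈ performed c ε R) : gv c (R k).x ≠ 0 :=
  norm_pos_iff.1 (hε.trans (h k le_rfl))

theorem HessLipOn.of_along {c : Vec N → Vec M} {ε L : ℝ} {R : ℕ → Iter N} {φ : Vec N → ℝ}
    (h : LipschitzHessAlong c ε R φ L) {k : ℕ} (hk : k ∈ performed c ε R) :
    HessLipOn φ L (R k).x (R k).s := h k hk

section Count

variable {P : Params} {f : Vec N → ℝ} {c : Vec N → Vec M} {Lv Lf V Δ ε α β : ℝ} {Bc Bf : ℕ}
  {R : ℕ → Iter N} {k a₁ a₂ e m l : ℕ}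

theorem CountInv.m_le (hb : CountBounds P Lv Lf Δ ε α β Bc Bf) {D : Iter N}
    (h : CountInv P f c Lv V Δ α β Bc Bf D k a₁ a₂ e m l) (hn : 0 < ‖D.n‖) : m ≤ Bc := by
  rcases m with - | j
  · exact Nat.zero_le _
  · refine hb.le_Bc j (le_of_mul_le_mul_right ?_ hn)
    exact (h.le_ratio j rfl).trans ((h.ratio_le (by omega)).trans
      (mul_le_mul_of_nonneg_right h.σ_mem.2 hn.le))

/-- The block length `1 + (Bc + 1) * (Bf + 1)` is one expansion, `Bc` contractions each with up to
`Bf` rejections before it, a last run of `Bf` rejections, and the current iteration. -/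
theorem CountInv.count_le (hb : CountBounds P Lv Lf Δ ε α β Bc Bf) {D : Iter N}
    (h : CountInv P f c Lv V Δ α β Bc Bf D k a₁ a₂ e m l) (hn : 0 < ‖D.n‖) :
    k + 1 ≤ (a₁ + a₂ + 1) * (1 + (Bc + 1) * (Bf + 1)) := by
  have h1 := h.count
  have h2 := h.e_le
  have h3 := h.l_le
  have h4 : m * (Bf + 1) ≤ Bc * (Bf + 1) := Nat.mul_le_mul_right _ (h.m_le hb hn)
  have h5 : (a₁ + a₂ + 1) * (1 + (Bc + 1) * (Bf + 1)) =
      (a₁ + a₂) * (1 + (Bc + 1) * (Bf + 1)) + (1 + (Bc * (Bf + 1) + (Bf + 1))) := by ring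
  omega

theorem vmax_decrease (P : Params) {v' vmax vmax' r : ℝ} (hv : v' ≤ vmax - P.κρ * r)
    (hle : vmax' ≤ v' + P.κv2 * (vmax - v')) :
    P.κρ * (1 - P.κv2) * r ≤ vmax - vmax' := by
  have := P.κv2_mem.2
  nlinarith

/-- An accepted step preserves the invariant. -/
theorem CountInv.accept (hb : CountBounds P Lv Lf Δ ε α β Bc Bf) {D D' : Iter N}
    (h : CountInv P f c Lv V Δ α β Bc Bf D k a₁ a₂ e m l) (hn : 0 < ‖D.n‖)
    (hdec : ∃ r, 0 ≤ r ∧ P.κρ * (1 - P.κv2) * r ^ 3 ≤ D.vmax - D'.vmax ∧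
      (ε ≤ (Lv + P.κht + sigmaMax P Lv / P.κtn ^ 2) * r ^ 2 ∨ P.κtn * Δ ≤ r))
    (hΔ : 0 < Δ) (hσ : D'.σ = D.σ) (hδ : D'.δv ≤ D'.δmax) (hmax : D.δmax ≤ D'.δmax)
    (hv : viol c D'.x ≤ D'.vmax) :
    ∃ a₁ a₂ e m l, CountInv P f c Lv V Δ α β Bc Bf D' (k + 1) a₁ a₂ e m l := by
  obtain ⟨r, hr, hdec, hcase⟩ := hdec
  have hcount := h.count_le hb hn
  have hd := h.decrease
  rcases hcase with hcase | hcase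
  · refine ⟨a₁ + 1, a₂, 0, 0, 0, ?_, by omega, by omega, by omega, by omega, by omega, by omega,
      ?_, hσ ▸ h.σ_mem, hδ, h.le_δmax.trans hmax, hv⟩
    · convert hcount using 1
      ring
    · have := hb.α_le r hr hcase
      push_cast
      linarith
  · refine ⟨a₁, a₂ + 1, 0, 0, 0, ?_, by omega, by omega, by omega, by omega, by omega, by omega,
      ?_, hσ ▸ h.σ_mem, hδ, h.le_δmax.trans hmax, hv⟩
    · convert hcount using 1
      ring
    · have h1 : (P.κtn * Δ) ^ 3 ≤ r ^ 3 :=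
        pow_le_pow_left₀ (mul_nonneg P.κtn_mem.1.le hΔ.le) hcase 3
      have h2 : 0 ≤ P.κρ * (1 - P.κv2) :=
        mul_nonneg P.κρ_mem.1.le (by linarith [P.κv2_mem.2])
      have := hb.β_le.trans (mul_le_mul_of_nonneg_left h1 h2)
      push_cast
      linarith

theorem CountInv.succ_of_isF (hf : ContDiff ℝ 2 f) (hc : ContDiff ℝ 2 c) (hε : 0 < ε)
    (hLv : 0 < Lv) (hLf : 0 < Lf) (hΔ : 0 < Δ)
    (hb : CountBounds P Lv Lf Δ ε α β Bc Bf) (hR : IsRun P f c ε R)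
    (hlv : LipschitzHessAlong c ε R (viol c) Lv) (hlf : LipschitzHessAlong c ε R f Lf)
    (hk' : k + 1 ∈ performed c ε R) (hF : IsF P f c (R k))
    (h : CountInv P f c Lv V Δ α β Bc Bf (R k) k a₁ a₂ e m l) :
    ∃ a₁ a₂ e m l, CountInv P f c Lv V Δ α β Bc Bf (R (k + 1)) (k + 1) a₁ a₂ e m l := by
  have hk := performed_of_succ hk'
  have hg := gv_ne_zero_of_performed hε hk
  have hst := hR.steps k hk
  have hst' := hR.steps _ hk'
  have hσ := hR.sigma_same k hk' (Or.inl hF)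
  have hn : 0 < ‖(R k).n‖ := norm_pos_iff.2 (hst.1.regSol.ne_zero hg)
  have hs := hst.norm_s_pos hg
  have hρ := P.κρ_mem.1
  have hσlo := P.σlo_pos
  have hc0 := P.γc_mem.1
  have hlam := hF.2.2.2.2.1
  have hvs := hF.2.2.1
  obtain ⟨hδv, hδmax, hacc | hrej⟩ := hR.update_F k hk hF
  · obtain ⟨-, hx, hvmax, -⟩ := hacc
    have hvs' : viol c (R (k + 1)).x ≤ (R k).vmax - P.κρ * ‖(R k).s‖ ^ 3 := by rwa [hx]
    refine h.accept hb hn ⟨‖(R k).s‖, hs.le, ?_, Or.inl ?_⟩ hΔ hσ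
      (by rw [hδv, hδmax]; exact h.δv_le) hδmax.ge ?_
    · exact vmax_decrease P hvs' (hvmax.trans_le (min_le_right _ _))
    · have h1 := hk' (k + 1) le_rfl
      rw [hx] at h1
      exact h1.le.trans (norm_gv_add_le hc hLv.le hst (.of_along hlv hk)
        (hσlo.le.trans (h.σ_mem.1.trans h.σ_mem.2))
        (hlam.trans (mul_le_mul_of_nonneg_right h.σ_mem.2 hn.le)))
    · rw [hvmax]
      refine le_min (hvs'.trans (le_max_right _ _)) ?_
      have h1 : 0 ≤ P.κρ * ‖(R k).s‖ ^ 3 := by positivity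
      exact le_add_of_nonneg_right (mul_nonneg P.κv2_mem.1.le (by linarith))
  · obtain ⟨hr, hx, hnn, hHH, hvmax, hcon⟩ := hrej
    -- Only `n` is kept by the update; the nonzero normal step determines its multiplier, so the
    -- V-ratio survives the rejection.
    have hlv' : (R (k + 1)).lamv = (R k).lamv := by
      have h1 := hst'.1.regSol
      rw [hx, hnn] at h1
      exact h1.multiplier_eq hg hst.1.regSol
    have hub := multiplier_lt_of_rhoF_lt hf hLf.le (hR.symm k hk) hg hst hF
      (.of_along hlf hk) hr
    have hle : (R (k + 1)).lamv ≤ (R (k + 1)).σ * ‖(R (k + 1)).n‖ := by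
      rwa [hlv', hσ, hnn]
    refine ⟨a₁, a₂, e, m, l + 1, ?_, h.e_le, ?_, fun _ => Or.inl hle, fun _ => hle,
      ?_, ?_, by rw [hvmax]; exact h.decrease, hσ ▸ h.σ_mem,
      by rw [hδv, hδmax]; exact h.δv_le, by rw [hδmax]; exact h.le_δmax,
      by rw [hx, hvmax]; exact h.viol_le⟩
    · have := h.count
      omega
    · rcases l with - | j
      · exact hb.one_le_Bf
      · refine hb.le_Bf j (lt_of_mul_lt_mul_right ?_ hs.le)
        refine lt_of_le_of_lt ?_ hub
        have h1 : 0 ≤ P.κfm * P.κst ^ 2 * (1 - P.κntt) :=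
          mul_nonneg (mul_nonneg P.κfm_mem.1.le (sq_nonneg _)) (by linarith [P.κntt_mem.2])
        have h2 := mul_le_mul_of_nonneg_right (h.le_ratioF j rfl hF) h1
        linarith
    · intro j hj
      rw [hnn, hlv']
      exact h.le_ratio j hj
    · intro j hj hF'
      obtain ⟨h1, h2⟩ := FContract.next (hR.symm k hk) hs hst hF hst' hF' hx hnn hHH hcon
      rcases l with - | i
      · obtain rfl : j = 0 := by omega
        simpa using h1
      · obtain rfl : j = i + 1 := by omega
        have h3 := h.le_ratioF i rfl hF
        have hinv : 1 ≤ P.γc⁻¹ := (one_le_inv₀ hc0).2 P.γc_mem.2.le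
        have h4 : P.σlo * ‖(R k).s‖ ≤ (R k).lamf := by
          refine le_trans (mul_le_mul_of_nonneg_right ?_ hs.le) h3
          exact le_mul_of_one_le_right hσlo.le (one_le_pow₀ hinv)
        have h5 := h2 h4 _ (by positivity) h3
        rwa [pow_succ, ← mul_assoc]

theorem CountInv.succ_of_not_isF (hc : ContDiff ℝ 2 c) (hε : 0 < ε)
    (hLv : 0 < Lv) (hΔ : 0 < Δ)
    (hb : CountBounds P Lv Lf Δ ε α β Bc Bf) (hR : IsRun P f c ε R)
    (hlv : LipschitzHessAlong c ε R (viol c) Lv)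
    (hk' : k + 1 ∈ performed c ε R) (hF : ¬ IsF P f c (R k))
    (h : CountInv P f c Lv V Δ α β Bc Bf (R k) k a₁ a₂ e m l) :
    ∃ a₁ a₂ e m l, CountInv P f c Lv V Δ α β Bc Bf (R (k + 1)) (k + 1) a₁ a₂ e m l := by
  have hk := performed_of_succ hk'
  have hg := gv_ne_zero_of_performed hε hk
  have hg' := gv_ne_zero_of_performed hε hk'
  have hst := hR.steps k hk
  have hst' := hR.steps _ hk'
  have hn : 0 < ‖(R k).n‖ := norm_pos_iff.2 (hst.1.regSol.ne_zero hg)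
  have hn' : 0 < ‖(R (k + 1)).n‖ := norm_pos_iff.2 (hst'.1.regSol.ne_zero hg')
  have hs := hst.norm_s_pos hg
  have hρ := P.κρ_mem.1
  have hσlo := P.σlo_pos
  have hσpos : 0 < (R k).σ := hσlo.trans_le h.σ_mem.1
  obtain ⟨-, hacc | hcon | hexp⟩ := hR.update_V k hk hF
  · obtain ⟨hr, hcase, hx, hvmax, hδmax, hδv⟩ := hacc
    have hσ := hR.sigma_same k hk' (Or.inr hr)
    have hvs : viol c (R (k + 1)).x ≤ viol c (R k).x - P.κρ * ‖(R k).s‖ ^ 3 := by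
      rw [rhoV, ge_iff_le, le_div_iff₀ (by positivity), ← hx] at hr
      linarith
    have h1 : 0 ≤ P.κρ * ‖(R k).s‖ ^ 3 := by positivity
    have hv0 := h.viol_le
    refine h.accept hb hn ⟨‖(R k).s‖, hs.le, ?_, ?_⟩ hΔ hσ
      (by rw [hδv]; exact min_le_left _ _) (by rw [hδmax]; exact le_max_left _ _) ?_
    · exact vmax_decrease P (by linarith) (hvmax.trans_le (min_le_right _ _))
    · rcases hcase with hlam | hmax
      · left
        have h1 := hk' (k + 1) le_rfl
        rw [hx] at h1
        exact h1.le.trans (norm_gv_add_le hc hLv.le hst (.of_along hlv hk)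
          (hσlo.le.trans (h.σ_mem.1.trans h.σ_mem.2))
          (hlam.trans (mul_le_mul_of_nonneg_right h.σ_mem.2 hn.le)))
      · right
        refine le_trans (mul_le_mul_of_nonneg_left ?_ P.κtn_mem.1.le) hst.le_norm_s
        rw [hmax]
        exact h.le_δmax
    · rw [hvmax]
      refine le_min (le_max_of_le_right ?_) ?_ <;>
        exact le_add_of_nonneg_right (mul_nonneg P.κv2_mem.1.le (by linarith))
  · obtain ⟨hr, hx, hvmax, hδmax, hcon⟩ := hcon
    have hσ := hR.sigma_contract k hk' hF hr
    have hns' := hst'.1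
    rw [hx] at hns'
    obtain ⟨c1, c2, c3, c4⟩ := hcon.next hc hg hst.1 hns'
      (multiplier_le_of_rhoV_lt hc hLv.le hg hst (.of_along hlv hk) hr)
    rw [← mul_assoc, ← sigmaMax] at c3
    -- The update of `σ` after a contraction absorbs the new ratio, which rules out an expansion
    -- afterwards.
    have hle : (R (k + 1)).lamv ≤ (R (k + 1)).σ * ‖(R (k + 1)).n‖ := by
      rw [← div_le_iff₀ hn', hσ]
      exact le_max_right _ _
    refine ⟨a₁, a₂, e, m + 1, 0, ?_, h.e_le, by omega, fun _ => Or.inl hle, fun _ => hle,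
      ?_, by omega, by rw [hvmax]; exact h.decrease, ?_, by rw [hδmax]; exact c1.trans h.δv_le,
      by rw [hδmax]; exact h.le_δmax, by rw [hx, hvmax]; exact h.viol_le⟩
    · have h1 := h.count
      have h2 := h.l_le
      have h3 : (m + 1) * (Bf + 1) = m * (Bf + 1) + (Bf + 1) := by ring
      omega
    · intro j hj
      rcases m with - | i
      · obtain rfl : j = 0 := by omega
        simpa using c2
      · obtain rfl : j = i + 1 := by omega
        have h3 := h.le_ratio i rfl
        have hmin : 1 ≤ min P.γlam P.γc⁻¹ :=
          le_min P.one_lt_γlam.le ((one_le_inv₀ P.γc_mem.1).2 P.γc_mem.2.le)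
        have h4 : P.σlo * ‖(R k).n‖ ≤ (R k).lamv := by
          refine le_trans (mul_le_mul_of_nonneg_right ?_ hn.le) h3
          exact le_mul_of_one_le_right hσlo.le (one_le_pow₀ hmin)
        have h5 := c4 _ h3 h4
        rwa [pow_succ, ← mul_assoc]
    · rw [hσ]
      exact ⟨h.σ_mem.1.trans (le_max_left _ _), max_le h.σ_mem.2 ((div_le_iff₀ hn').2 c3)⟩
  · obtain ⟨hr, hnot, hx, hvmax, hδmax, hδv⟩ := hexp
    have hσ := hR.sigma_same k hk' (Or.inr hr)
    have hzero : e + m + l = 0 := by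
      by_contra hne
      exact hnot (h.no_expand (Nat.pos_of_ne_zero hne))
    push Not at hnot
    have hns' := hst'.1
    rw [hx] at hns'
    refine ⟨a₁, a₂, 1, 0, 0, ?_, le_rfl, by omega, fun _ => ?_, by omega, by omega, by omega,
      by rw [hvmax]; exact h.decrease, hσ ▸ h.σ_mem, by rw [hδv]; exact min_le_left _ _,
      by rw [hδmax]; exact h.le_δmax, by rw [hx, hvmax]; exact h.viol_le⟩
    · have h1 := h.count
      obtain ⟨⟨rfl, rfl⟩, rfl⟩ : (e = 0 ∧ m = 0) ∧ l = 0 := by omega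
      simpa using h1
    -- After an expansion no second one is possible. A positive multiplier puts the new normal step
    -- on the boundary, of radius either `δmax` or `lamv / σ`; in the latter case the radius did not
    -- shrink, so the multiplier did not grow and is at most `σ` times the new norm.
    · rcases hns'.2.2.2.2.1.eq_or_lt with h0 | hpos
      · left
        rw [← h0, hσ]
        positivity
      · have heq := hns'.norm_eq hpos
        rw [hδv] at heq
        rcases min_choice (R (k + 1)).δmax ((R k).lamv / (R k).σ) with hm | hm
        · right
          rw [heq, hm]
        · left
          have hlampos : 0 < (R k).lamv := (mul_pos hσpos hn).trans hnot.1
          have h1 : (R k).δv ≤ (R (k + 1)).δv := by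
            rw [hδv, hδmax]
            refine le_min h.δv_le ?_
            rw [← hst.1.norm_eq hlampos, le_div_iff₀ hσpos, mul_comm]
            exact hnot.1.le
          have h2 := hst.1.multiplier_le hg hns' h1
          rw [heq, hm, hσ, mul_div_cancel₀ _ hσpos.ne']
          exact h2

theorem exists_countInv (hf : ContDiff ℝ 2 f) (hc : ContDiff ℝ 2 c) (hε : 0 < ε)
    (hLv : 0 < Lv) (hLf : 0 < Lf) (hΔ : 0 < Δ)
    (hb : CountBounds P Lv Lf Δ ε α β Bc Bf) (hR : IsRun P f c ε R)
    (hV : (R 0).vmax = V) (hmax : (R 0).δmax = Δ)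
    (hlv : LipschitzHessAlong c ε R (viol c) Lv) (hlf : LipschitzHessAlong c ε R f Lf)
    (hk : k ∈ performed c ε R) :
    ∃ a₁ a₂ e m l, CountInv P f c Lv V Δ α β Bc Bf (R k) k a₁ a₂ e m l := by
  induction k with
  | zero =>
    refine ⟨0, 0, 0, 0, 0, by omega, by omega, by omega, by omega, by omega, by omega, by omega,
      by simp [hV], ⟨hR.init_σ.1, hR.init_σ.2.trans (le_max_left _ _)⟩, hR.init_δmax, hmax.ge,
      (le_max_right _ _).trans hR.init_vmax⟩
  | succ k ih =>
    obtain ⟨a₁, a₂, e, m, l, h⟩ := ih (performed_of_succ hk)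
    by_cases hF : IsF P f c (R k)
    · exact h.succ_of_isF hf hc hε hLv hLf hΔ hb hR hlv hlf hk hF
    · exact h.succ_of_not_isF hc hε hLv hΔ hb hR hlv hk hF

end Count

/-! ### The constants of the bound -/

theorem sigmaMax_ge (P : Params) (Lv : ℝ) : P.σlo ≤ sigmaMax P Lv :=
  P.σlo_le_σhi.trans (le_max_left _ _)

theorem one_lt_min_growth (P : Params) : 1 < min P.γlam P.γc⁻¹ :=
  lt_min P.one_lt_γlam ((one_lt_inv₀ P.γc_mem.1).2 P.γc_mem.2)

theorem one_le_KCv (P : Params) (Lv : ℝ) : 1 ≤ KCv P Lv := by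
  have h1 := Real.log_pos (one_lt_min_growth P)
  have h2 : 0 ≤ Real.log (sigmaMax P Lv / P.σlo) :=
    Real.log_nonneg ((one_le_div P.σlo_pos).2 (sigmaMax_ge P Lv))
  have : 0 ≤ ⌊1 / Real.log (min P.γlam P.γc⁻¹) * Real.log (sigmaMax P Lv / P.σlo)⌋ :=
    Int.floor_nonneg.2 (by positivity)
  unfold KCv
  linarith

theorem one_le_KCf (P : Params) (Lf : ℝ) : 1 ≤ KCf P Lf := le_max_left _ _

theorem natCast_le_floor_log {μ y : ℝ} (hμ : 1 < μ) {j : ℕ} (h : μ ^ j ≤ y) :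
    (j : ℤ) ≤ ⌊1 / Real.log μ * Real.log y⌋ := by
  have h1 := Real.log_pos hμ
  have h2 := Real.log_le_log (by positivity) h
  rw [Real.log_pow] at h2
  rw [Int.le_floor, one_div_mul_eq_div, le_div_iff₀ h1]
  exact_mod_cast h2

/-- The decrease of the funnel radius in an accepted step with a small multiplier. -/
def alphaConst (P : Params) (Lv ε : ℝ) : ℝ :=
  P.κρ * (1 - P.κv2) * (Lv + P.κht + sigmaMax P Lv / P.κtn ^ 2) ^ (-(3 / 2) : ℝ) *
    ε ^ (3 / 2 : ℝ)

theorem growth_base_pos (P : Params) {Lv : ℝ} (hLv : 0 < Lv) :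
    0 < Lv + P.κht + sigmaMax P Lv / P.κtn ^ 2 := by
  have := P.κht_pos
  have h1 : 0 < sigmaMax P Lv := P.σlo_pos.trans_le (sigmaMax_ge P Lv)
  have := P.κtn_mem.1
  positivity

theorem alphaConst_pos (P : Params) {Lv ε : ℝ} (hLv : 0 < Lv) (hε : 0 < ε) :
    0 < alphaConst P Lv ε := by
  have h1 := growth_base_pos P hLv
  have h2 := P.κρ_mem.1
  have h3 : 0 < 1 - P.κv2 := by linarith [P.κv2_mem.2]
  unfold alphaConst
  positivity

theorem Kσ_eq_floor (P : Params) {Lv V ε : ℝ} (hε : 0 < ε) :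
    Kσ P Lv V ε = ⌊V / alphaConst P Lv ε⌋ := by
  rw [Kσ, alphaConst, Real.rpow_neg hε.le]
  congr 1
  rw [← div_eq_mul_inv, div_div]

/-- Raising the quadratic bound on `ε` to the power `3/2` produces `r ^ 3`; this is the source of
the exponent in the complexity bound. -/
theorem alphaConst_le (P : Params) {Lv ε r : ℝ} (hLv : 0 < Lv) (hε : 0 < ε) (hr : 0 ≤ r)
    (h : ε ≤ (Lv + P.κht + sigmaMax P Lv / P.κtn ^ 2) * r ^ 2) :
    alphaConst P Lv ε ≤ P.κρ * (1 - P.κv2) * r ^ 3 := by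
  have hQ := growth_base_pos P hLv
  have h3 : 0 ≤ P.κρ * (1 - P.κv2) := mul_nonneg P.κρ_mem.1.le (by linarith [P.κv2_mem.2])
  set Q := Lv + P.κht + sigmaMax P Lv / P.κtn ^ 2
  rw [alphaConst, mul_assoc]
  refine mul_le_mul_of_nonneg_left ?_ h3
  have h4 : ε ^ (3 / 2 : ℝ) ≤ Q ^ (3 / 2 : ℝ) * r ^ 3 := by
    calc ε ^ (3 / 2 : ℝ) ≤ (Q * r ^ 2) ^ (3 / 2 : ℝ) :=
          Real.rpow_le_rpow hε.le h (by norm_num)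
      _ = Q ^ (3 / 2 : ℝ) * r ^ 3 := by
        rw [Real.mul_rpow hQ.le (by positivity), ← Real.rpow_natCast r 2, ← Real.rpow_mul hr,
          ← Real.rpow_natCast r 3]
        norm_num
  rw [Real.rpow_neg hQ.le, inv_mul_le_iff₀ (by positivity)]
  exact h4

theorem countBounds (P : Params) {Lv Lf Δ ε : ℝ} (hLv : 0 < Lv) (hε : 0 < ε) :
    CountBounds P Lv Lf Δ ε (alphaConst P Lv ε) (P.κρ * P.κtn ^ 3 * (1 - P.κv2) * Δ ^ 3)
      (KCv P Lv).toNat (KCf P Lf).toNat where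
  α_le r hr h := alphaConst_le P hLv hε hr h
  β_le := le_of_eq (by ring)
  le_Bc j h := by
    have h1 : min P.γlam P.γc⁻¹ ^ j ≤ sigmaMax P Lv / P.σlo := by
      rwa [le_div_iff₀' P.σlo_pos]
    have h2 := natCast_le_floor_log (one_lt_min_growth P) h1
    rw [Int.le_toNat (by linarith [one_le_KCv P Lv]), KCv]
    push_cast
    linarith
  one_le_Bf := by
    rw [Int.le_toNat (by linarith [one_le_KCf P Lf])]
    exact_mod_cast one_le_KCf P Lf
  le_Bf j h := by
    have h0 : 0 < P.σlo * P.κfm * P.κst ^ 2 * (1 - P.κntt) := by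
      have := P.σlo_pos
      have := P.κfm_mem.1
      have := P.κst_mem.1
      have : 0 < 1 - P.κntt := by linarith [P.κntt_mem.2]
      positivity
    have h1 : P.γc⁻¹ ^ j ≤ (P.κhs + Lf + 2 * P.κρ) /
        (P.σlo * P.κfm * P.κst ^ 2 * (1 - P.κntt)) := by
      rw [le_div_iff₀ h0]
      linarith
    have h2 := natCast_le_floor_log ((one_lt_inv₀ P.γc_mem.1).2 P.γc_mem.2) h1
    rw [Int.le_toNat (by linarith [one_le_KCf P Lf]), KCf]
    push_cast
    exact le_max_of_le_right (by linarith)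

theorem beta_pos (P : Params) {Δ : ℝ} (hΔ : 0 < Δ) :
    0 < P.κρ * P.κtn ^ 3 * (1 - P.κv2) * Δ ^ 3 := by
  have := P.κρ_mem.1
  have := P.κtn_mem.1
  have : 0 < 1 - P.κv2 := by linarith [P.κv2_mem.2]
  positivity

theorem Kσ_nonneg (P : Params) {Lv V ε : ℝ} (hLv : 0 < Lv) (hV : 0 ≤ V) (hε : 0 < ε) :
    0 ≤ Kσ P Lv V ε := by
  rw [Kσ_eq_floor P hε]
  exact Int.floor_nonneg.2 (div_nonneg hV (alphaConst_pos P hLv hε).le)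

theorem KΔ_nonneg (P : Params) {V Δ : ℝ} (hV : 0 ≤ V) (hΔ : 0 < Δ) : 0 ≤ KΔ P V Δ :=
  Int.floor_nonneg.2 (div_nonneg hV (beta_pos P hΔ).le)

theorem one_le_K (P : Params) {Lv V Δ ε : ℝ} (Lf : ℝ) (hLv : 0 < Lv) (hV : 0 ≤ V) (hΔ : 0 < Δ)
    (hε : 0 < ε) : 1 ≤ K P Lv Lf V Δ ε := by
  have h1 := Kσ_nonneg P hLv hV hε
  have h2 := KΔ_nonneg P hV hΔ
  have h3 := one_le_KCv P Lv
  have h4 := one_le_KCf P Lf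
  have h5 : 0 ≤ (KCv P Lv + 1) * (KCf P Lf + 1) := mul_nonneg (by linarith) (by linarith)
  exact one_le_mul_of_one_le_of_one_le (by linarith) (by linarith)

/-! ### Termination and the order of the bound -/

theorem succ_le_K_of_performed {P : Params} {f : Vec N → ℝ} {c : Vec N → Vec M}
    {Lv Lf V Δ ε : ℝ} {R : ℕ → Iter N} {k : ℕ} (hf : ContDiff ℝ 2 f) (hc : ContDiff ℝ 2 c)
    (hε : 0 < ε) (hLv : 0 < Lv) (hLf : 0 < Lf) (hΔ : 0 < Δ) (hR : IsRun P f c ε R)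
    (hV : (R 0).vmax = V) (hmax : (R 0).δmax = Δ)
    (hlv : LipschitzHessAlong c ε R (viol c) Lv) (hlf : LipschitzHessAlong c ε R f Lf)
    (hk : k ∈ performed c ε R) : ((k + 1 : ℕ) : ℤ) ≤ K P Lv Lf V Δ ε := by
  have hb := countBounds P (Lf := Lf) (Δ := Δ) hLv hε
  obtain ⟨a₁, a₂, e, m, l, h⟩ :=
    exists_countInv hf hc hε hLv hLf hΔ hb hR hV hmax hlv hlf hk
  have hn : 0 < ‖(R k).n‖ :=
    norm_pos_iff.2 ((hR.steps k hk).1.regSol.ne_zero (gv_ne_zero_of_performed hε hk))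
  have hcount : ((k + 1 : ℕ) : ℤ) ≤ _ := Int.ofNat_le.2 (h.count_le hb hn)
  have hα := alphaConst_pos P hLv hε
  have hβ := beta_pos P hΔ
  have hdec := h.decrease
  -- Since `vmax` is nonnegative, the total decrease is at most `V`; this bounds `a₁` and `a₂`
  -- separately.
  have hv := (viol_nonneg c _).trans h.viol_le
  have h1 : (a₁ : ℤ) ≤ Kσ P Lv V ε := by
    rw [Kσ_eq_floor P hε, Int.le_floor, le_div_iff₀ hα]
    have : 0 ≤ (a₂ : ℝ) * (P.κρ * P.κtn ^ 3 * (1 - P.κv2) * Δ ^ 3) := by positivity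
    push_cast
    linarith
  have h2 : (a₂ : ℤ) ≤ KΔ P V Δ := by
    rw [KΔ, Int.le_floor, le_div_iff₀ hβ]
    have : 0 ≤ (a₁ : ℝ) * alphaConst P Lv ε := by positivity
    push_cast
    linarith
  have h3 := one_le_KCv P Lv
  have h4 := one_le_KCf P Lf
  push_cast [Int.toNat_of_nonneg (show 0 ≤ KCv P Lv by linarith),
    Int.toNat_of_nonneg (show 0 ≤ KCf P Lf by linarith)] at hcount ⊢
  refine hcount.trans (mul_le_mul_of_nonneg_right (by linarith) ?_)
  have h5 : 0 ≤ (KCv P Lv + 1) * (KCf P Lf + 1) := mul_nonneg (by linarith) (by linarith)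
  linarith

theorem exists_performed_eq_Iio {c : Vec N → Vec M} {ε : ℝ} {R : ℕ → Iter N} {B : ℤ}
    (hB : 0 ≤ B) (h : ∀ k ∈ performed c ε R, ((k + 1 : ℕ) : ℤ) ≤ B) :
    ∃ k : ℕ, (k : ℤ) ≤ B ∧ performed c ε R = Set.Iio k ∧ ‖gv c (R k).x‖ ≤ ε := by
  classical
  have hex : ∃ k, ‖gv c (R k).x‖ ≤ ε := by
    by_contra! hcon
    -- Without termination the index `B` itself would be performed, giving `B + 1 ≤ B`.
    have := h B.toNat (fun j _ => hcon j)
    omega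
  refine ⟨Nat.find hex, ?_, ?_, Nat.find_spec hex⟩
  · rcases hfind : Nat.find hex with - | k
    · simpa using hB
    · refine h k fun j hj => not_le.1 (Nat.find_min hex ?_)
      omega
  · ext k
    rw [Set.mem_Iio, Nat.lt_find_iff]
    exact forall₂_congr fun j _ => not_le.symm

theorem K_le_const_mul_rpow (P : Params) {Lv V Δ εbar ε : ℝ} (Lf : ℝ)
    (hV : 0 ≤ V) (hΔ : 0 < Δ) (hε : ε ∈ Set.Ioo 0 εbar) :
    (K P Lv Lf V Δ ε : ℝ) ≤ ((1 + KΔ P V Δ) * εbar ^ (3 / 2 : ℝ) + V / alphaConst P Lv 1) *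
      (1 + (KCv P Lv + 1) * (KCf P Lf + 1)) * ε ^ (-(3 / 2) : ℝ) := by
  have hΔ0 : (0 : ℝ) ≤ KΔ P V Δ := by exact_mod_cast KΔ_nonneg P hV hΔ
  have h3 : (1 : ℝ) ≤ KCv P Lv := by exact_mod_cast one_le_KCv P Lv
  have h4 : (1 : ℝ) ≤ KCf P Lf := by exact_mod_cast one_le_KCf P Lf
  have h5 : (Kσ P Lv V ε : ℝ) ≤ V / alphaConst P Lv 1 * ε ^ (-(3 / 2) : ℝ) := by
    refine (Int.floor_le _).trans (le_of_eq ?_)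
    rw [alphaConst, Real.one_rpow, mul_one]
  -- Lets the terms independent of `ε` be absorbed into a multiple of `ε ^ (-3/2)`.
  have h6 : 1 ≤ εbar ^ (3 / 2 : ℝ) * ε ^ (-(3 / 2) : ℝ) := by
    rw [Real.rpow_neg hε.1.le, ← div_eq_mul_inv, one_le_div (Real.rpow_pos_of_pos hε.1 _)]
    exact Real.rpow_le_rpow hε.1.le hε.2.le (by norm_num)
  have h7 := mul_le_mul_of_nonneg_left h6 (show (0 : ℝ) ≤ 1 + KΔ P V Δ by linarith)
  have h8 : (0 : ℝ) ≤ (KCv P Lv + 1) * (KCf P Lf + 1) := mul_nonneg (by linarith) (by linarith)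
  rw [K, mul_right_comm]
  push_cast
  refine mul_le_mul_of_nonneg_right ?_ (by linarith)
  linarith

end TrustFunnel

end

theorem mainTheorem1 {N M : ℕ} (P : TrustFunnel.Params) (Lv Lf V Δ : ℝ)
    (hLv : 0 < Lv) (hLf : 0 < Lf) (hV : 1 ≤ V) (hΔ : 0 < Δ) :
    (∀ (f : TrustFunnel.Vec N → ℝ) (c : TrustFunnel.Vec N → TrustFunnel.Vec M) (ε : ℝ)
        (R : ℕ → TrustFunnel.Iter N),
      ContDiff ℝ 2 f → ContDiff ℝ 2 c → 0 < ε →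
      TrustFunnel.IsRun P f c ε R → (R 0).vmax = V → (R 0).δmax = Δ →
      TrustFunnel.BoundedRun c ε R →
      TrustFunnel.LipschitzHessAlong c ε R (TrustFunnel.viol c) Lv →
      TrustFunnel.LipschitzHessAlong c ε R f Lf →
      (TrustFunnel.performed c ε R).Finite ∧
      ((TrustFunnel.performed c ε R).ncard : ℤ) ≤ TrustFunnel.K P Lv Lf V Δ ε ∧
      ∃ k : ℕ, (k : ℤ) ≤ TrustFunnel.K P Lv Lf V Δ ε ∧
        TrustFunnel.performed c ε R = Set.Iio k ∧
        ‖gradient (TrustFunnel.viol c) (R k).x‖ ≤ ε) ∧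
    (∀ εbar : ℝ, 0 < εbar → ∃ C : ℝ, ∀ ε ∈ Set.Ioo 0 εbar,
      0 ≤ TrustFunnel.K P Lv Lf V Δ ε ∧
      (TrustFunnel.K P Lv Lf V Δ ε : ℝ) ≤ C * ε ^ (-(3 / 2) : ℝ)) := by
  have hV0 : 0 ≤ V := by linarith
  refine ⟨?_, fun εbar _ =>
    ⟨_, fun ε hε => ⟨?_, TrustFunnel.K_le_const_mul_rpow P Lf hV0 hΔ hε⟩⟩⟩
  · intro f c ε R hf hc hε hR hRV hRΔ _ hlv hlf
    have hK := TrustFunnel.one_le_K P Lf hLv hV0 hΔ hε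
    obtain ⟨k, hk, hperf, hgv⟩ := TrustFunnel.exists_performed_eq_Iio (by linarith)
      (fun k hk => TrustFunnel.succ_le_K_of_performed (Lf := Lf) hf hc hε hLv hLf hΔ hR hRV hRΔ
        hlv hlf hk)
    refine ⟨hperf ▸ Set.finite_Iio k, ?_, k, hk, hperf, ?_⟩
    · rw [hperf, Set.ncard_eq_toFinset_card']
      simpa using hk
    · rw [TrustFunnel.gradient_viol_eq hc]
      exact hgv
  · linarith [TrustFunnel.one_le_K P Lf hLv hV0 hΔ hε.1]
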